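/- Let $h(x)=-x\log_2 x-(1-x)\log_2(1-x)$ be the binary entropy function. The function $h(x)(2-h(x))-h(2x-x^2)$ has a largest root $b$ in the open interval $(0,1)$. Put $a=\frac{1-h(b)}{2-h(b)}$ and $c=a+(1-a)b$. Then $0.3823455<c<0.3823456$; in particular $c>\frac{3-\sqrt5}{2}$. For every $n$ and every nonempty union-closed family $\mathcal F\subset 2^{[n]}$ (that is, $A\cup B\in\mathcal F$ for all $A,B\in\mathcal F$) with $\mathcal F\neq\{\emptyset\}$, there is an element $i\in[n]$ that belongs to at least $c|\mathcal F|$ of the sets in $\mathcal F$. -/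

import Mathlib

/-- The binary entropy function to base 2:
`h x = -(x * log₂ x + (1 - x) * log₂ (1 - x))`. -/
noncomputable def binEntropyTwo (x : ℝ) : ℝ := Real.binEntropy x / Real.log 2

theorem binEntropyTwo_eq (x : ℝ) :
    binEntropyTwo x = -(x * Real.logb 2 x + (1 - x) * Real.logb 2 (1 - x)) := by
  simp only [binEntropyTwo, Real.binEntropy_eq_negMulLog_add_negMulLog_one_sub, Real.negMulLog,
    Real.logb]
  ring

/-- The roots in the open interval `(0, 1)` of the function
`x ↦ h x * (2 - h x) - h (2 * x - x ^ 2)`. -/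
def criticalRoots : Set ℝ :=
  {x | 0 < x ∧ x < 1 ∧
    binEntropyTwo x * (2 - binEntropyTwo x) - binEntropyTwo (2 * x - x ^ 2) = 0}

/-- The weight `a = (1 - h b) / (2 - h b)` of the atom at `1`. -/
noncomputable def atomWeight (b : ℝ) : ℝ := (1 - binEntropyTwo b) / (2 - binEntropyTwo b)

/-- The expectation `a + (1 - a) * b` of a random variable that equals `1` with probability
`a = atomWeight b` and `b` with probability `1 - a`. -/
noncomputable def twoPointMean (b : ℝ) : ℝ := atomWeight b + (1 - atomWeight b) * b

/-- A family of subsets of an `n`-element ground set is union-closed if it contains the union of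
any two of its members. -/
def UnionClosed {n : ℕ} (F : Finset (Finset (Fin n))) : Prop :=
  ∀ A ∈ F, ∀ B ∈ F, A ∪ B ∈ F

open Real

/-! ### Rational enclosures of logarithms -/

/-! Let A and B be uniform members of F, revealed one element at a time. However they are coupled, A
∪ B lies in F, so its entropy is at most log |F| (`sum_entropy_coupling_le_log_card`), while A alone
has entropy log |F|. If every element had frequency below c, an average over two couplings would
give A ∪ B more entropy than A, a contradiction. The couplings are the independent one (weight 1 -
α) and the one that at each step brings the disjunction of the two bits as close to a fair bit as
the marginals allow (weight α).

At one step let x be the conditional probability that the next bit is 0; its mean X exceeds 1 - c =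
1/(2k). The second coupling of the earlier prefixes is not under control, so the gain
`CriticalParameters.entropy_gain` must hold for every coupling of the law of x with itself. Linear
programming duality achieves this: φ = `dualPotential` satisfies φ(x) + φ(y) - log 2 ≤
h(disjunction), so the coupled entropy is at least twice the mean of φ minus log 2. What remains
follows by integrating the pointwise inequality `CriticalParameters.kernel_nonneg` against the
product law. Its multiplier ξ = `truncatedId` is only required to satisfy 0 ≤ ξ(x) ≤ x; it is cut to
0 above 15/16 because at x = y = 1 the entropies vanish and the dual term with ξ(x) = x would be
negative.

When x and y lie on the same side of 15/16, concavity of h(z)/z as a function of log z reduces the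
pointwise inequality to x = y. Below 15/16 the diagonal has a double zero at β = 1 - b: the choices
of b and k make it vanish there, and α is chosen to kill the derivative. Convexity around β,
concavity further right and series bounds near 0 give its sign. The mixed range has slack and is
checked on finitely many rectangles. The two-point law with mass a at x = 0 and 1 - a at x = β gives
the independent disjunction exactly the entropy of a single bit, which explains the formula for c.
-/

theorem log_enclosure {u v : ℝ} (hv : 0 < v) (huv : v ≤ u) (n : ℕ) :
    2 * ∑ i ∈ Finset.range n, ((u - v) / (u + v)) ^ (2 * i + 1) / (2 * i + 1) ≤ log u - log v ∧
    log u - log v ≤ 2 * ((∑ i ∈ Finset.range n, ((u - v) / (u + v)) ^ (2 * i + 1) / (2 * i + 1)) +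
      ((u - v) / (u + v)) ^ (2 * n + 1) / (1 - ((u - v) / (u + v)) ^ 2)) := by
  have hu : 0 < u := hv.trans_le huv
  have h0 : 0 ≤ (u - v) / (u + v) := div_nonneg (by linarith) (by linarith)
  have h1 : (u - v) / (u + v) < 1 := by rw [div_lt_one (by linarith)]; linarith
  -- The substitution t = (u - v)/(u + v) turns log (u/v) into 2 artanh t, whose odd power series
  -- has a geometric tail bound.
  have e : (1 + (u - v) / (u + v)) / (1 - (u - v) / (u + v)) = u / v := by
    have : u + v ≠ 0 := by linarith
    field_simp
    ring_nf
    field_simp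
  have a := sum_range_le_log_div h0 h1 n
  have b := log_div_le_sum_range_add h0 h1 n
  rw [e, log_div hu.ne' hv.ne'] at a b
  constructor <;> linarith

theorem log_two_enclosure : 0.69314718055 < log 2 ∧ log 2 < 0.69314718057 := by
  have h := log_enclosure (u := 2) (v := 1) (by norm_num) (by norm_num) 12
  norm_num [Finset.sum_range_succ] at h
  constructor <;> linarith [h.1, h.2]

theorem log_three_enclosure : 1.09861228865 < log 3 ∧ log 3 < 1.09861228869 := by
  have h := log_enclosure (u := 3) (v := 2) (by norm_num) (by norm_num) 8
  have h2 := log_two_enclosure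
  norm_num [Finset.sum_range_succ] at h
  constructor <;> linarith [h.1, h.2, h2.1, h2.2]

theorem log_five_enclosure : 1.60943791240 < log 5 ∧ log 5 < 1.60943791246 := by
  have h := log_enclosure (u := 5) (v := 2 ^ 2) (by norm_num) (by norm_num) 6
  have h2 := log_two_enclosure
  rw [log_pow] at h
  norm_num [Finset.sum_range_succ] at h
  constructor <;> linarith [h.1, h.2, h2.1, h2.2]

theorem log_seven_enclosure : 1.9459101 < log 7 ∧ log 7 < 1.9459102 := by
  have h := log_enclosure (u := 2 ^ 3) (v := 7) (by norm_num) (by norm_num) 4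
  have h2 := log_two_enclosure
  rw [log_pow] at h
  norm_num [Finset.sum_range_succ] at h
  constructor <;> linarith [h.1, h.2, h2.1, h2.2]

theorem log_eleven_enclosure : 2.39789527275 < log 11 ∧ log 11 < 2.39789527284 := by
  -- The ratio 121/120 is so close to 1 that three terms give ten digits.
  have h := log_enclosure (u := 11 ^ 2) (v := 2 ^ 3 * 3 * 5) (by norm_num) (by norm_num) 3
  have h2 := log_two_enclosure
  have h3 := log_three_enclosure
  have h5 := log_five_enclosure
  rw [log_mul (by norm_num) (by norm_num), log_mul (by norm_num) (by norm_num), log_pow,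
    log_pow] at h
  norm_num [Finset.sum_range_succ] at h
  constructor <;> linarith [h.1, h.2, h2.1, h2.2]

theorem log_thirteen_enclosure : 2.5649493 < log 13 ∧ log 13 < 2.5649494 := by
  have h := log_enclosure (u := 13) (v := 2 ^ 2 * 3) (by norm_num) (by norm_num) 4
  have h2 := log_two_enclosure
  have h3 := log_three_enclosure
  rw [log_mul (by norm_num) (by norm_num), log_pow] at h
  norm_num [Finset.sum_range_succ] at h
  constructor <;> linarith [h.1, h.2, h2.1, h2.2]

theorem log_twentynine_enclosure : 3.3672958 < log 29 ∧ log 29 < 3.3672959 := by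
  have h := log_enclosure (u := 2 * 3 * 5) (v := 29) (by norm_num) (by norm_num) 3
  have h2 := log_two_enclosure
  have h3 := log_three_enclosure
  have h5 := log_five_enclosure
  rw [log_mul (by norm_num) (by norm_num), log_mul (by norm_num) (by norm_num)] at h
  norm_num [Finset.sum_range_succ] at h
  constructor <;> linarith [h.1, h.2, h2.1, h2.2]

theorem log_thirtyone_enclosure : 3.4339872 < log 31 ∧ log 31 < 3.4339873 := by
  have h := log_enclosure (u := 2 ^ 5) (v := 31) (by norm_num) (by norm_num) 3
  have h2 := log_two_enclosure
  rw [log_pow] at h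
  norm_num [Finset.sum_range_succ] at h
  constructor <;> linarith [h.1, h.2, h2.1, h2.2]

theorem log_sixtyone_enclosure : 4.1108738 < log 61 ∧ log 61 < 4.1108739 := by
  have h := log_enclosure (u := 61) (v := 2 ^ 2 * 3 * 5) (by norm_num) (by norm_num) 3
  have h2 := log_two_enclosure
  have h3 := log_three_enclosure
  have h5 := log_five_enclosure
  rw [log_mul (by norm_num) (by norm_num), log_mul (by norm_num) (by norm_num), log_pow] at h
  norm_num [Finset.sum_range_succ] at h
  constructor <;> linarith [h.1, h.2, h2.1, h2.2]

/-! ### The critical root -/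

theorem binEntropy_eq_neg (p : ℝ) : binEntropy p = -(p * log p) - (1 - p) * log (1 - p) := by
  rw [binEntropy_eq_negMulLog_add_negMulLog_one_sub, negMulLog, negMulLog]; ring

/-- The function whose zeros in `(0, 1)` are the critical roots, in natural units. -/
noncomputable def entropyGap (p : ℝ) : ℝ :=
  binEntropy p * (2 * log 2 - binEntropy p) - log 2 * binEntropy (2 * p - p ^ 2)

/-- The multipliers 3, 3 and 20 bring the three arguments close to 1, 2 and 11, so short series
suffice. -/
theorem logs_at_lower_endpoint :
    (-1.11031632455 < log 0.32945473 ∧ log 0.32945473 < -1.11031632440) ∧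
    (-0.39966406183 < log 0.67054527 ∧ log 0.67054527 < -0.39966406170) ∧
    (-0.59716624245 < log (2 * 0.32945473 - 0.32945473 ^ 2) ∧
      log (2 * 0.32945473 - 0.32945473 ^ 2) < -0.59716624218) := by
  have h2 := log_two_enclosure
  have h3 := log_three_enclosure
  have h5 := log_five_enclosure
  have h11 := log_eleven_enclosure
  refine ⟨?_, ?_, ?_⟩
  · have h := log_enclosure (u := 1) (v := 3 * 0.32945473) (by norm_num) (by norm_num) 3
    rw [log_mul (by norm_num) (by norm_num)] at h
    norm_num [Finset.sum_range_succ] at h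
    norm_num
    constructor <;> linarith [h.1, h.2]
  · have h := log_enclosure (u := 3 * 0.67054527) (v := 2) (by norm_num) (by norm_num) 3
    rw [log_mul (by norm_num) (by norm_num)] at h
    norm_num [Finset.sum_range_succ] at h
    norm_num
    constructor <;> linarith [h.1, h.2]
  · have h := log_enclosure (u := 2 ^ 2 * 5 * (2 * 0.32945473 - 0.32945473 ^ 2)) (v := 11)
      (by norm_num) (by norm_num) 2
    rw [log_mul (by norm_num) (by norm_num), log_mul (by norm_num) (by norm_num), log_pow] at h
    norm_num [Finset.sum_range_succ] at h
    norm_num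
    constructor <;> linarith [h.1, h.2]

theorem logs_at_upper_endpoint :
    (-1.11031626384 < log 0.32945475 ∧ log 0.32945475 < -1.11031626369) ∧
    (-0.39966409166 < log 0.67054525 ∧ log 0.67054525 < -0.39966409152) ∧
    (-0.59716619376 < log (2 * 0.32945475 - 0.32945475 ^ 2) ∧
      log (2 * 0.32945475 - 0.32945475 ^ 2) < -0.59716619350) := by
  have h2 := log_two_enclosure
  have h3 := log_three_enclosure
  have h5 := log_five_enclosure
  have h11 := log_eleven_enclosure
  refine ⟨?_, ?_, ?_⟩
  · have h := log_enclosure (u := 1) (v := 3 * 0.32945475) (by norm_num) (by norm_num) 3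
    rw [log_mul (by norm_num) (by norm_num)] at h
    norm_num [Finset.sum_range_succ] at h
    norm_num
    constructor <;> linarith [h.1, h.2]
  · have h := log_enclosure (u := 3 * 0.67054525) (v := 2) (by norm_num) (by norm_num) 3
    rw [log_mul (by norm_num) (by norm_num)] at h
    norm_num [Finset.sum_range_succ] at h
    norm_num
    constructor <;> linarith [h.1, h.2]
  · have h := log_enclosure (u := 2 ^ 2 * 5 * (2 * 0.32945475 - 0.32945475 ^ 2)) (v := 11)
      (by norm_num) (by norm_num) 2
    rw [log_mul (by norm_num) (by norm_num), log_mul (by norm_num) (by norm_num), log_pow] at h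
    norm_num [Finset.sum_range_succ] at h
    norm_num
    constructor <;> linarith [h.1, h.2]

theorem binEntropy_lower_endpoint :
    0.63379181101 < binEntropy 0.32945473 ∧ binEntropy 0.32945473 < 0.63379181118 := by
  obtain ⟨h1, h2, -⟩ := logs_at_lower_endpoint
  rw [binEntropy_eq_neg, show (1 : ℝ) - 0.32945473 = 0.67054527 by norm_num]
  constructor <;> linarith [h1.1, h1.2, h2.1, h2.2]

theorem binEntropy_upper_endpoint :
    0.63379182522 < binEntropy 0.32945475 ∧ binEntropy 0.32945475 < 0.63379182540 := by
  obtain ⟨h1, h2, -⟩ := logs_at_upper_endpoint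
  rw [binEntropy_eq_neg, show (1 : ℝ) - 0.32945475 = 0.67054525 by norm_num]
  constructor <;> linarith [h1.1, h1.2, h2.1, h2.2]

theorem entropyGap_lower_endpoint_neg : entropyGap 0.32945473 < 0 := by
  obtain ⟨h1, h2, h3⟩ := logs_at_lower_endpoint
  obtain ⟨a, b⟩ := binEntropy_lower_endpoint
  obtain ⟨c, d⟩ := log_two_enclosure
  have hz : 0.68806448270 < binEntropy (2 * 0.32945473 - 0.32945473 ^ 2) := by
    -- Since 1 - (2p - p²) = (1 - p)², only the logarithms already enclosed occur.
    rw [binEntropy_eq_neg,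
      show (1 : ℝ) - (2 * 0.32945473 - 0.32945473 ^ 2) = 0.67054527 ^ 2 by norm_num, log_pow]
    push_cast
    linarith [h2.1, h2.2, h3.1, h3.2]
  unfold entropyGap
  nlinarith [mul_lt_mul'' b d (by linarith) (by linarith),
    mul_lt_mul'' a a (by linarith) (by linarith),
    mul_lt_mul'' c hz (by linarith) (by linarith)]

theorem entropyGap_upper_endpoint_pos : 0 < entropyGap 0.32945475 := by
  obtain ⟨h1, h2, h3⟩ := logs_at_upper_endpoint
  obtain ⟨a, b⟩ := binEntropy_upper_endpoint
  obtain ⟨c, d⟩ := log_two_enclosure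
  have hz : binEntropy (2 * 0.32945475 - 0.32945475 ^ 2) < 0.68806447765 := by
    rw [binEntropy_eq_neg,
      show (1 : ℝ) - (2 * 0.32945475 - 0.32945475 ^ 2) = 0.67054525 ^ 2 by norm_num, log_pow]
    push_cast
    linarith [h2.1, h2.2, h3.1, h3.2]
  have hz0 : 0 ≤ binEntropy (2 * 0.32945475 - 0.32945475 ^ 2) :=
    binEntropy_nonneg (by norm_num) (by norm_num)
  unfold entropyGap
  nlinarith [mul_lt_mul'' a c (by linarith) (by linarith),
    mul_lt_mul'' b b (by linarith) (by linarith),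
    mul_lt_mul'' d hz (by linarith) hz0]

theorem continuous_entropyGap : Continuous entropyGap := by
  unfold entropyGap
  fun_prop

theorem entropyGap_eq (p : ℝ) :
    binEntropyTwo p * (2 - binEntropyTwo p) - binEntropyTwo (2 * p - p ^ 2) =
      entropyGap p / log 2 ^ 2 := by
  have : log 2 ≠ 0 := (log_pos one_lt_two).ne'
  unfold entropyGap binEntropyTwo
  field_simp

/-- Both factors of the gap move in the right direction between `0.3` and `1 / 2`. -/
theorem entropyGap_strictMonoOn : StrictMonoOn entropyGap (Set.Icc 0.3 (1 / 2)) := by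
  intro x hx y hy hxy
  obtain ⟨hx0, hx1⟩ := hx
  obtain ⟨hy0, hy1⟩ := hy
  have hL : 0 < log 2 := log_pos one_lt_two
  have h1 : binEntropy x < binEntropy y :=
    binEntropy_strictMonoOn ⟨by linarith, by linarith⟩ ⟨by linarith, by linarith⟩ hxy
  have h2 : binEntropy y ≤ log 2 := binEntropy_le_log_two
  -- For x ≥ 0.3 > 1 - 1/√2 one has 2x - x² ≥ 1/2, the decreasing branch of the entropy.
  have h3 : binEntropy (2 * y - y ^ 2) < binEntropy (2 * x - x ^ 2) := by
    apply binEntropy_strictAntiOn ⟨by nlinarith, by nlinarith⟩ ⟨by nlinarith, by nlinarith⟩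
    nlinarith
  unfold entropyGap
  nlinarith [mul_lt_mul_of_pos_left h3 hL]

/-- As h(p) ≤ log 2, the first product is at least log 2 · h(p), so it is enough that 2p - p² has
smaller entropy than p. For p ≤ 1/2 this means 2p - p² > 1 - p, that is p > (3 - √5)/2 ≈ 0.38197. -/
theorem entropyGap_pos_of_le {p : ℝ} (h0 : 0.39 ≤ p) (h1 : p < 1) : 0 < entropyGap p := by
  have hL : 0 < log 2 := log_pos one_lt_two
  have hp : 0 < binEntropy p := binEntropy_pos (by linarith) h1
  have h2 : binEntropy p ≤ log 2 := binEntropy_le_log_two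
  have key : binEntropy (2 * p - p ^ 2) < binEntropy p := by
    rcases le_total p (1 / 2) with hp2 | hp2
    · rw [← binEntropy_one_sub p]
      exact binEntropy_strictAntiOn ⟨by linarith, by linarith⟩ ⟨by nlinarith, by nlinarith⟩
        (by nlinarith)
    · exact binEntropy_strictAntiOn ⟨by linarith, by linarith⟩ ⟨by nlinarith, by nlinarith⟩
        (by nlinarith)
  unfold entropyGap
  nlinarith [mul_lt_mul_of_pos_left key hL, mul_nonneg hp.le (sub_nonneg.2 h2)]

theorem exists_isGreatest_criticalRoots :
    ∃ b : ℝ, IsGreatest criticalRoots b ∧ 0.32945473 < b ∧ b < 0.32945475 ∧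
      entropyGap b = 0 := by
  have hL : 0 < log 2 := log_pos one_lt_two
  obtain ⟨b, ⟨hb0, hb1⟩, hb⟩ := intermediate_value_Ioo (by norm_num : (0.32945473 : ℝ) ≤ 0.32945475)
    continuous_entropyGap.continuousOn
    ⟨entropyGap_lower_endpoint_neg, entropyGap_upper_endpoint_pos⟩
  refine ⟨b, ⟨⟨by linarith, by linarith, ?_⟩, ?_⟩, hb0, hb1, hb⟩
  · rw [entropyGap_eq, hb, zero_div]
  · rintro x ⟨hx0, hx1, hx⟩
    rw [entropyGap_eq, div_eq_zero_iff, or_iff_left (by positivity)] at hx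
    by_contra! hbx
    rcases le_total x (1 / 2) with h | h
    · have := entropyGap_strictMonoOn ⟨by linarith, by linarith⟩ ⟨by linarith, h⟩ hbx
      linarith
    · linarith [entropyGap_pos_of_le (by linarith) hx1]

/-! ### The slope `k = 1 / (2 (1 - c))` and the mixing weight `α` -/

/-- Numerical enclosures of the parameters and the two equations that tie them to `β = 1 - b`. -/
structure CriticalParameters (β k α : ℝ) : Prop where
  beta_gt : 0.67054525 < β
  beta_lt : β < 0.67054527
  k_gt : 0.80951406 < k
  k_lt : k < 0.80951416
  alpha_gt : 0.035605 < α
  alpha_lt : α < 0.035609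
  -- `slope` and `critical` together make the diagonal of the kernel vanish at β for every α;
  -- `tangent` says that its derivative vanishes there too, and so determines α.
  slope : 2 * k * (log 2 * β) = 2 * log 2 - binEntropy β
  critical : log 2 * binEntropy (β ^ 2) = binEntropy β * (2 * log 2 - binEntropy β)
  tangent : (1 - α) * (2 * β * (log (1 - β ^ 2) - log (β ^ 2))) -
      2 * k * (binEntropy β + β * (log (1 - β) - log β)) + 4 * α * k * log 2 -
      8 * α * k ^ 2 * log 2 * β = 0

/-- In natural units 1 - a = log 2 / (2 log 2 - h(b)), and 1 - c = (1 - a)(1 - b). This matches k =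
1/(2(1 - c)) with the slope equation. -/
theorem one_sub_twoPointMean {b : ℝ} (h : 2 * log 2 - binEntropy b ≠ 0) :
    1 - twoPointMean b = log 2 * (1 - b) / (2 * log 2 - binEntropy b) := by
  have hL : log 2 ≠ 0 := (log_pos one_lt_two).ne'
  have ha : atomWeight b = 1 - log 2 / (2 * log 2 - binEntropy b) := by
    unfold atomWeight binEntropyTwo
    rw [show 2 - binEntropy b / log 2 = (2 * log 2 - binEntropy b) / log 2 by field_simp]
    rw [div_div_eq_mul_div, eq_sub_iff_add_eq, ← add_div, div_eq_one_iff_eq h]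
    field_simp
    ring
  unfold twoPointMean
  rw [ha]
  ring

set_option maxHeartbeats 1600000 in
theorem exists_criticalParameters {b : ℝ} (h0 : 0.32945473 < b) (h1 : b < 0.32945475)
    (hb : entropyGap b = 0) :
    ∃ k α : ℝ, CriticalParameters (1 - b) k α ∧ 2 * k * (1 - twoPointMean b) = 1 := by
  obtain ⟨L0, L1⟩ := log_two_enclosure
  have hh0 : 0.63379181101 < binEntropy b := binEntropy_lower_endpoint.1.trans
    (binEntropy_strictMonoOn ⟨by norm_num, by norm_num⟩ ⟨by linarith, by linarith⟩ h0)
  have hh1 : binEntropy b < 0.63379182540 := lt_trans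
    (binEntropy_strictMonoOn ⟨by linarith, by linarith⟩ ⟨by norm_num, by norm_num⟩ h1)
    binEntropy_upper_endpoint.2
  obtain ⟨⟨p1, -⟩, ⟨-, p2⟩, ⟨p3, -⟩⟩ := logs_at_lower_endpoint
  obtain ⟨⟨-, q1⟩, ⟨q2, -⟩, ⟨-, q3⟩⟩ := logs_at_upper_endpoint
  have lb0 : -1.11031633 < log b := by
    linarith [log_lt_log (by norm_num) h0]
  have lb1 : log b < -1.11031626 := by
    linarith [log_lt_log (by linarith) h1]
  have lc0 : -0.39966410 < log (1 - b) := by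
    linarith [log_lt_log (by norm_num) (show (0.67054525 : ℝ) < 1 - b by linarith)]
  have lc1 : log (1 - b) < -0.39966406 := by
    linarith [log_lt_log (by linarith) (show 1 - b < (0.67054527 : ℝ) by linarith)]
  have lz0 : -0.59716625 < log (1 - (1 - b) ^ 2) := by
    have : log (2 * 0.32945473 - 0.32945473 ^ 2) < log (1 - (1 - b) ^ 2) :=
      log_lt_log (by norm_num) (by nlinarith)
    linarith
  have lz1 : log (1 - (1 - b) ^ 2) < -0.59716619 := by
    have : log (1 - (1 - b) ^ 2) < log (2 * 0.32945475 - 0.32945475 ^ 2) :=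
      log_lt_log (by nlinarith) (by nlinarith)
    linarith
  set L := log 2 with hL
  set β := 1 - b with hβ
  set e := binEntropy b with he
  have β0 : 0.67054525 < β := by linarith
  have β1 : β < 0.67054527 := by linarith
  have eβ : binEntropy β = e := by rw [hβ, binEntropy_one_sub]
  have Lβ0 : 0.69314718055 * 0.67054525 < L * β :=
    mul_lt_mul'' L0 β0 (by norm_num) (by norm_num)
  have Lβ1 : L * β < 0.69314718057 * 0.67054527 :=
    mul_lt_mul'' L1 β1 (by linarith) (by linarith)
  have Lβp : 0 < 2 * (L * β) := by linarith
  set k := (2 * L - e) / (2 * (L * β)) with hk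
  have k0 : 0.80951406 < k := by rw [hk, lt_div_iff₀ Lβp]; linarith
  have k1 : k < 0.80951416 := by rw [hk, div_lt_iff₀ Lβp]; linarith
  have kL : 2 * k * (L * β) = 2 * L - e := by
    rw [hk]; field_simp
  set A := 2 * β * (log (1 - β ^ 2) - log (β ^ 2)) with hA
  set B := e + β * (log b - log β) with hB
  have lβ2 : log (β ^ 2) = 2 * log β := by rw [log_pow]; norm_num
  have s0 : 0.20216187 < log (1 - β ^ 2) - 2 * log β := by linarith
  have s1 : log (1 - β ^ 2) - 2 * log β < 0.20216201 := by linarith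
  have A0 : 0.2711172 < A := by
    rw [hA, lβ2]
    linarith [mul_lt_mul'' β0 s0 (by norm_num) (by norm_num)]
  have A1 : A < 0.2711177 := by
    rw [hA, lβ2]
    linarith [mul_lt_mul'' β1 s1 (by linarith) (by linarith)]
  have r0 : 0.71065216 < log β - log b := by linarith
  have r1 : log β - log b < 0.71065227 := by linarith
  have B0 : 0.1572672 < B := by
    rw [hB]
    linarith [mul_lt_mul'' β1 r1 (by linarith) (by linarith)]
  have B1 : B < 0.1572675 := by
    rw [hB]
    linarith [mul_lt_mul'' β0 r0 (by norm_num) (by norm_num)]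
  -- The tangency equation is linear in α and reads α D = A - 2 k B.
  set D := A - 4 * k * L + 8 * k ^ 2 * L * β with hD
  -- The slope equation removes k², leaving a form without cancellation that is easy to enclose.
  have kk : D = A + 4 * (k * (L - e)) := by
    have : 8 * k ^ 2 * L * β = 4 * k * (2 * L - e) := by rw [← kL]; ring
    rw [hD, this]; ring
  have le0 : 0.05935535 < L - e := by linarith
  have le1 : L - e < 0.05935538 := by linarith
  have D0 : 0.46331 < D := by
    rw [kk]
    linarith [mul_lt_mul'' k0 le0 (by norm_num) (by norm_num)]
  have D1 : D < 0.463315 := by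
    rw [kk]
    linarith [mul_lt_mul'' k1 le1 (by linarith) (by linarith)]
  have kB0 : 0.80951406 * 0.1572672 < k * B := mul_lt_mul'' k0 B0 (by norm_num) (by norm_num)
  have kB1 : k * B < 0.80951416 * 0.1572675 := mul_lt_mul'' k1 B1 (by linarith) (by linarith)
  clear_value D B A k
  obtain ⟨α, hα⟩ : ∃ α, α = (A - 2 * (k * B)) / D := ⟨_, rfl⟩
  have hαD : α * D = A - 2 * (k * B) := by
    rw [hα, div_mul_cancel₀]; linarith
  refine ⟨k, α, ⟨β0, β1, k0, k1, ?_, ?_, ?_, ?_, ?_⟩, ?_⟩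
  · rw [hα, lt_div_iff₀ (by linarith)]; linarith
  · rw [hα, div_lt_iff₀ (by linarith)]; linarith
  · rw [eβ, kL]
  · have h2 : binEntropy (β ^ 2) = binEntropy (2 * b - b ^ 2) := by
      rw [← binEntropy_one_sub]; congr 1; rw [hβ]; ring
    rw [eβ, h2]
    unfold entropyGap at hb
    linarith
  · have hb1 : 1 - β = b := by rw [hβ]; ring
    rw [eβ, hb1, ← hA, ← hB]
    linear_combination α * hD - hαD
  · have h2 : (2 : ℝ) * L - e ≠ 0 := by linarith
    have hm := one_sub_twoPointMean h2
    rw [hm, mul_div_assoc', kL, div_self h2]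

/-! ### Log-concavity of `h x / x` and the series of `(1 - z) log (1 - z)` -/

/-- Multiply the series of -log (1 - z) by z and subtract the same series without its first term. -/
theorem hasSum_add_one_sub_mul_log {z : ℝ} (hz : |z| < 1) :
    HasSum (fun n : ℕ => z ^ (n + 2) / ((n + 1) * (n + 2))) (z + (1 - z) * log (1 - z)) := by
  have h1 := hasSum_pow_div_log_of_abs_lt_one hz
  have h2 := (hasSum_nat_add_iff' 1).2 h1
  convert! (h1.mul_left z).sub h2 using 1
  · funext n
    push_cast
    have a : (n : ℝ) + 1 ≠ 0 := by positivity
    have b : (n : ℝ) + 2 ≠ 0 := by positivity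
    have e : (n : ℝ) + 1 + 1 = n + 2 := by ring
    rw [e]
    field_simp
    ring
  · simp
    ring

/-- By the preceding series, h(z)/z = 1 - log z - ∑ zⁿ⁺¹/((n+1)(n+2)). The logarithm is affine in
log z and each power is convex in log z, so h(z)/z is concave in log z; xy is the geometric mean of
x² and y². Termwise this is a perfect square. -/
theorem log_concavity_binEntropy {x y : ℝ} (hx0 : 0 < x) (hx1 : x < 1) (hy0 : 0 < y)
    (hy1 : y < 1) :
    y ^ 2 * binEntropy (x ^ 2) + x ^ 2 * binEntropy (y ^ 2) ≤ 2 * (x * y) * binEntropy (x * y) := by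
  have a1 : |x ^ 2| < 1 := by rw [abs_of_pos (by positivity)]; nlinarith
  have a2 : |y ^ 2| < 1 := by rw [abs_of_pos (by positivity)]; nlinarith
  have a3 : |x * y| < 1 := by rw [abs_of_pos (by positivity)]; nlinarith
  have key : 2 * (x * y) * (x * y + (1 - x * y) * log (1 - x * y)) ≤
      y ^ 2 * (x ^ 2 + (1 - x ^ 2) * log (1 - x ^ 2)) +
      x ^ 2 * (y ^ 2 + (1 - y ^ 2) * log (1 - y ^ 2)) := by
    refine hasSum_le ?_ ((hasSum_add_one_sub_mul_log a3).mul_left (2 * (x * y)))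
      (((hasSum_add_one_sub_mul_log a1).mul_left (y ^ 2)).add
        ((hasSum_add_one_sub_mul_log a2).mul_left (x ^ 2)))
    intro n
    rw [mul_div_assoc', mul_div_assoc', mul_div_assoc', ← add_div]
    apply div_le_div_of_nonneg_right _ (by positivity)
    have := sq_nonneg (y * x ^ (n + 2) - x * y ^ (n + 2))
    have e1 : (x ^ 2) ^ (n + 2) = (x ^ (n + 2)) ^ 2 := by rw [← pow_mul, ← pow_mul, mul_comm]
    have e2 : (y ^ 2) ^ (n + 2) = (y ^ (n + 2)) ^ 2 := by rw [← pow_mul, ← pow_mul, mul_comm]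
    rw [e1, e2, mul_pow]
    nlinarith
  simp only [binEntropy_eq_neg]
  rw [log_mul hx0.ne' hy0.ne', log_pow, log_pow]
  push_cast
  nlinarith

/-! ### The diagonal inequality near zero -/

theorem neg_log_one_sub_ge {z : ℝ} (h0 : 0 ≤ z) (h1 : z < 1) :
    z + z ^ 2 / 2 + z ^ 3 / 3 ≤ -log (1 - z) := by
  have h := sum_le_hasSum (Finset.range 3) (fun n _ => by positivity)
    (hasSum_pow_div_log_of_abs_lt_one (x := z) (by rwa [abs_of_nonneg h0]))
  norm_num [Finset.sum_range_succ] at h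
  linarith

theorem add_one_sub_mul_log_ge {z : ℝ} (h0 : 0 ≤ z) (h1 : z < 1) :
    z ^ 2 / 2 + z ^ 3 / 6 + z ^ 4 / 12 ≤ z + (1 - z) * log (1 - z) := by
  have h := sum_le_hasSum (Finset.range 3) (fun n _ => by positivity)
    (hasSum_add_one_sub_mul_log (z := z) (by rwa [abs_of_nonneg h0]))
  norm_num [Finset.sum_range_succ] at h
  linarith

/-- This is the diagonal near 0 after dividing by x². With c = 2αk, the constants bound 2(1 - α) -
2(k - c), 1 + log 2, 1 - α, 2(k - c) and 2ck log 2. -/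
theorem smallPolynomial_nonneg {x : ℝ} (hx0 : 0 ≤ x) (hx1 : x ≤ 1 / 2) :
    0 ≤ 0.4250 * (1.69314718055 - 2 * x) + (0.964391 - 1.503739) - 0.0647012 -
      0.964395 * (x ^ 2 / 2 + x ^ 4 / 6 + x ^ 6 / 3) +
      1.50372 * (x / 2 + x ^ 2 / 6 + x ^ 3 / 12) := by
  have g1 : x ^ 2 ≤ x / 2 := by nlinarith
  have g3 : 0 ≤ x ^ 3 := by positivity
  have g4 : x ^ 4 ≤ x ^ 3 / 2 := by nlinarith [mul_nonneg g3 (sub_nonneg.2 hx1)]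
  have g6 : x ^ 6 ≤ x ^ 3 / 8 := by
    have : x ^ 3 ≤ 1 / 8 := by
      calc x ^ 3 ≤ (1 / 2) ^ 3 := by gcongr
        _ = 1 / 8 := by norm_num
    nlinarith
  linarith

namespace CriticalParameters

variable {β k α : ℝ}

theorem weight_bounds (h : CriticalParameters β k α) :
    0.057645 < 2 * α * k ∧ 2 * α * k < 0.057653 := by
  obtain ⟨-, -, k0, k1, a0, a1, -, -, -⟩ := h
  constructor <;> nlinarith

theorem weight_mul_slope_bounds (h : CriticalParameters β k α) :
    0.046663 < 2 * α * k * k ∧ 2 * α * k * k < 0.046672 := by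
  obtain ⟨c0, c1⟩ := h.weight_bounds
  obtain ⟨-, -, k0, k1, a0, a1, -, -, -⟩ := h
  constructor <;> nlinarith

theorem diagonal_nonneg_of_le_half (h : CriticalParameters β k α) {x : ℝ} (hx0 : 0 < x)
    (hx1 : x ≤ 1 / 2) :
    0 ≤ (1 - α) * binEntropy (x ^ 2) - 2 * k * (x * binEntropy x) +
      2 * (2 * α * k) * (x * (binEntropy x - log 2 * k * x)) := by
  obtain ⟨c0, c1⟩ := h.weight_bounds
  obtain ⟨e0, e1⟩ := h.weight_mul_slope_bounds
  obtain ⟨-, -, k0, k1, a0, a1, -, -, -⟩ := h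
  obtain ⟨L0, L1⟩ := log_two_enclosure
  set c := 2 * α * k
  set L := log 2
  -- Tangent of the logarithm at 1/2.
  have hl : log x ≤ 2 * x - 1 - L := by
    have := log_le_sub_one_of_pos (show 0 < 2 * x by linarith)
    rw [log_mul two_ne_zero hx0.ne'] at this
    linarith
  have hs := neg_log_one_sub_ge (z := x ^ 2) (by positivity) (by nlinarith)
  have hs2 := add_one_sub_mul_log_ge hx0.le (by linarith)
  have hz : x ^ 2 + (1 - x ^ 2) * log (1 - x ^ 2) ≤
      (x ^ 2) ^ 2 / 2 + (x ^ 2) ^ 3 / 6 + (x ^ 2) ^ 4 / 3 := by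
    nlinarith [mul_le_mul_of_nonneg_left hs (show 0 ≤ 1 - x ^ 2 by nlinarith)]
  set p := x ^ 2 + (1 - x ^ 2) * log (1 - x ^ 2) with hp
  set q := x + (1 - x) * log (1 - x) with hq
  have b1 : binEntropy (x ^ 2) = -(2 * x ^ 2 * log x) + x ^ 2 - p := by
    rw [binEntropy_eq_neg, log_pow, hp]; push_cast; ring
  have b2 : binEntropy x = -(x * log x) + x - q := by
    rw [binEntropy_eq_neg, hq]; ring
  -- The leading behaviour is x² log (1/x) with a positive coefficient; p and q collect the
  -- remainders, of order x⁴ and x².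
  have id : (1 - α) * binEntropy (x ^ 2) - 2 * k * (x * binEntropy x) +
      2 * c * (x * (binEntropy x - L * k * x)) =
      x ^ 2 * ((2 * (1 - α) - 2 * (k - c)) * (-log x) + ((1 - α) - 2 * (k - c)) - 2 * (c * k) * L)
      - (1 - α) * p + 2 * (k - c) * (x * q) := by
    rw [b1, b2]; ring
  rw [id]
  have t1 : (0.4250 : ℝ) * (1 + L - 2 * x) ≤ (2 * (1 - α) - 2 * (k - c)) * (-log x) :=
    mul_le_mul (by linarith) (by linarith) (by linarith) (by linarith)
  have t2 : c * k * L ≤ 0.046672 * 0.69314718057 := by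
    apply mul_le_mul e1.le L1.le (by linarith) (by norm_num)
  have t3 : (1 - α) * p ≤ 0.964395 * ((x ^ 2) ^ 2 / 2 + (x ^ 2) ^ 3 / 6 + (x ^ 2) ^ 4 / 3) :=
    mul_le_mul (by linarith) hz (by
      have := add_one_sub_mul_log_ge (z := x ^ 2) (by positivity) (by nlinarith)
      refine le_trans (by positivity) this) (by norm_num)
  have t4 : 1.50372 * (x * (x ^ 2 / 2 + x ^ 3 / 6 + x ^ 4 / 12)) ≤ 2 * (k - c) * (x * q) :=
    mul_le_mul (by linarith) (mul_le_mul_of_nonneg_left hs2 hx0.le) (by positivity) (by linarith)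
  have t5 : x ^ 2 * (0.4250 * (1 + L - 2 * x) + (0.964391 - 1.503739) - 0.0647012) ≤
      x ^ 2 * ((2 * (1 - α) - 2 * (k - c)) * (-log x) + ((1 - α) - 2 * (k - c)) -
        2 * (c * k) * L) :=
    mul_le_mul_of_nonneg_left (by linarith) (by positivity)
  have t6 := mul_nonneg (sq_nonneg x) (smallPolynomial_nonneg hx0.le hx1)
  linarith [mul_nonneg (sq_nonneg x) (show 0 ≤ L - 0.69314718055 by linarith)]

end CriticalParameters

/-! ### Derivatives of `A h(x²) - K x h(x)` -/

/-- The combination of entropies on the diagonal of the kernel. -/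
noncomputable def entropyDiagonal (A K x : ℝ) : ℝ :=
  A * binEntropy (x ^ 2) - K * (x * binEntropy x)

/-- The derivative of `entropyDiagonal`. -/
noncomputable def entropyDiagonalDeriv (A K x : ℝ) : ℝ :=
  A * (2 * x * (log (1 - x ^ 2) - log (x ^ 2))) -
    K * (binEntropy x + x * (log (1 - x) - log x))

/-- The second derivative of `entropyDiagonal`. -/
noncomputable def entropyDiagonalDeriv2 (A K x : ℝ) : ℝ :=
  A * (2 * (log (1 - x ^ 2) - log (x ^ 2)) - 4 / (1 - x ^ 2)) +
    K * (1 / (1 - x) - 2 * (log (1 - x) - log x))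

theorem continuous_entropyDiagonal (A K : ℝ) : Continuous (entropyDiagonal A K) := by
  unfold entropyDiagonal
  fun_prop

theorem hasDerivAt_entropyDiagonal (A K : ℝ) {x : ℝ} (h0 : 0 < x) (h1 : x < 1) :
    HasDerivAt (entropyDiagonal A K) (entropyDiagonalDeriv A K x) x := by
  have hx2 : x ^ 2 ≠ 1 := by nlinarith
  have hsq : HasDerivAt (fun y : ℝ => y ^ 2) (2 * x) x := by simpa using hasDerivAt_pow 2 x
  have a := HasDerivAt.comp (h := fun y : ℝ => y ^ 2) x
    (hasDerivAt_binEntropy (pow_ne_zero 2 h0.ne') hx2) hsq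
  have b := (hasDerivAt_id' x).fun_mul (hasDerivAt_binEntropy h0.ne' h1.ne)
  have := (a.const_mul A).sub (b.const_mul K)
  convert! this using 1
  unfold entropyDiagonalDeriv
  ring

theorem hasDerivAt_entropyDiagonalDeriv (A K : ℝ) {x : ℝ} (h0 : 0 < x) (h1 : x < 1) :
    HasDerivAt (entropyDiagonalDeriv A K) (entropyDiagonalDeriv2 A K x) x := by
  have hx2 : 1 - x ^ 2 ≠ 0 := by nlinarith
  have hx1 : 1 - x ≠ 0 := by linarith
  have hsq : HasDerivAt (fun y : ℝ => y ^ 2) (2 * x) x := by simpa using hasDerivAt_pow 2 x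
  have hid := hasDerivAt_id' x
  have a1 := (hsq.const_sub 1).log hx2
  have a2 := hsq.log (pow_ne_zero 2 h0.ne')
  have a := (hid.const_mul 2).fun_mul (a1.fun_sub a2)
  have b1 := (hid.const_sub 1).log hx1
  have b2 := hid.log h0.ne'
  have b := (hasDerivAt_binEntropy h0.ne' h1.ne).fun_add (hid.fun_mul (b1.fun_sub b2))
  have := (a.const_mul A).fun_sub (b.const_mul K)
  convert! this using 1
  unfold entropyDiagonalDeriv2
  have e1 : 2 * x * (-(2 * x) / (1 - x ^ 2) - 2 * x / x ^ 2) = - 4 / (1 - x ^ 2) := by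
    field_simp
    ring
  have e2 : x * (-1 / (1 - x) - 1 / x) = - 1 / (1 - x) := by
    field_simp
    ring
  rw [e1, e2]
  ring

/-! ### Rational bounds for logarithms and signs of the second-derivative coefficients -/

theorem log_one_sub_sq {x : ℝ} (h0 : 0 < x) (h1 : x < 1) :
    log (1 - x ^ 2) = log (1 - x) + log (1 + x) := by
  rw [← log_mul (by linarith) (by linarith)]
  congr 1
  ring

theorem log_ge_chord {x : ℝ} (h0 : 1 / 2 ≤ x) (h1 : x ≤ 1) : -(2 * log 2 * (1 - x)) ≤ log x := by
  have := strictConcaveOn_log_Ioi.concaveOn.2 (show (1 : ℝ) ∈ Set.Ioi 0 by simp)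
    (show (1 / 2 : ℝ) ∈ Set.Ioi 0 by simp) (show 0 ≤ 2 * x - 1 by linarith)
    (show 0 ≤ 2 - 2 * x by linarith) (by ring)
  simp only [smul_eq_mul, log_one, one_div, log_inv] at this
  have e : (2 * x - 1) * 1 + (2 - 2 * x) * 2⁻¹ = x := by ring
  rw [e] at this
  linarith

theorem log_le_of_scale {s y : ℝ} (hs : 0 < s) (hy : 0 < y) : log y ≤ y / s - 1 + log s := by
  have := log_le_sub_one_of_pos (div_pos hy hs)
  rw [log_div hy.ne' hs.ne'] at this
  linarith

/-- Tangent at s in the variable 1/y. The resulting pole merges with those of the second derivative,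
so that clearing denominators leaves a polynomial. -/
theorem neg_log_le_of_scale {s y : ℝ} (hs : 0 < s) (hy : 0 < y) :
    -log y ≤ s / y - 1 - log s := by
  have := log_le_sub_one_of_pos (div_pos hs hy)
  rw [log_div hs.ne' hy.ne'] at this
  linarith

/-- The signs of the coefficients of A and K allow both to be replaced by their numerical extremes.
-/
theorem entropyDiagonalDeriv2_coeff_nonpos {x : ℝ} (h0 : 1 / 2 ≤ x) (h1 : x < 1) :
    2 * (log (1 - x ^ 2) - log (x ^ 2)) - 4 / (1 - x ^ 2) ≤ 0 := by
  have hx : 0 < 1 - x ^ 2 := by nlinarith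
  have a := log_le_sub_one_of_pos (div_pos hx (show 0 < x ^ 2 by positivity))
  rw [log_div hx.ne' (by positivity)] at a
  have b : (1 - x ^ 2) / x ^ 2 ≤ 3 := by
    rw [div_le_iff₀ (by positivity)]; nlinarith
  have c : 4 ≤ 4 / (1 - x ^ 2) := by
    rw [le_div_iff₀ hx]; nlinarith
  linarith

theorem entropyDiagonalDeriv2_coeff_nonneg {x : ℝ} (h0 : 1 / 2 ≤ x) (h1 : x < 1) :
    0 ≤ 1 / (1 - x) - 2 * (log (1 - x) - log x) := by
  have a : log (1 - x) ≤ log x := log_le_log (by linarith) (by linarith)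
  have b : 0 ≤ 1 / (1 - x) := by
    apply div_nonneg <;> linarith
  linarith

/-- A convex function with a critical zero is nonnegative. -/
theorem ConvexOn.nonneg_of_critical_zero {f : ℝ → ℝ} {S : Set ℝ} (hf : ConvexOn ℝ S f) {x y : ℝ}
    (hx : x ∈ S) (hy : y ∈ S) (h0 : f x = 0) (h1 : HasDerivAt f 0 x) : 0 ≤ f y := by
  rcases lt_trichotomy x y with h | h | h
  · have := hf.le_slope_of_hasDerivAt hx hy h h1
    rw [slope_def_field, h0, sub_zero] at this
    by_contra! hn
    exact absurd this (not_le.2 (div_neg_of_neg_of_pos hn (sub_pos.2 h)))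
  · rw [← h, h0]
  · have := hf.slope_le_of_hasDerivAt hy hx h h1
    rw [slope_def_field, h0, zero_sub] at this
    by_contra! hn
    exact absurd this (not_le.2 (div_pos (neg_pos.2 hn) (sub_pos.2 h)))

/-! ### Entropies at the right endpoints of the diagonal ranges -/

theorem binEntropy_ratio {a b : ℝ} (ha : 0 < a) (hb : 0 < b) :
    binEntropy (a / (a + b)) = log (a + b) - (a * log a + b * log b) / (a + b) := by
  have e : 1 - a / (a + b) = b / (a + b) := by field_simp; ring
  rw [binEntropy_eq_neg, e, log_div ha.ne' (by positivity), log_div hb.ne' (by positivity)]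
  field_simp
  ring

theorem binEntropy_seven_eighths : 0.376770 < binEntropy (7 / 8) ∧
    binEntropy (7 / 8) < 0.376771 := by
  have h := binEntropy_ratio (a := 7) (b := 1) (by norm_num) (by norm_num)
  norm_num at h
  have h8 : log 8 = 3 * log 2 := by
    rw [show (8 : ℝ) = 2 ^ 3 by norm_num, log_pow]; norm_num
  rw [h, h8]
  obtain ⟨a, b⟩ := log_two_enclosure
  obtain ⟨c, d⟩ := log_seven_enclosure
  constructor <;> linarith

theorem binEntropy_fifteen_sixteenths : 0.233791 < binEntropy (15 / 16) ∧
    binEntropy (15 / 16) < 0.233793 := by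
  have h := binEntropy_ratio (a := 15) (b := 1) (by norm_num) (by norm_num)
  norm_num at h
  have h16 : log 16 = 4 * log 2 := by
    rw [show (16 : ℝ) = 2 ^ 4 by norm_num, log_pow]; norm_num
  have h15 : log 15 = log 3 + log 5 := by
    rw [show (15 : ℝ) = 3 * 5 by norm_num, log_mul (by norm_num) (by norm_num)]
  rw [h, h15, h16]
  obtain ⟨a, b⟩ := log_two_enclosure
  obtain ⟨c, d⟩ := log_three_enclosure
  obtain ⟨e, f⟩ := log_five_enclosure
  constructor <;> linarith

theorem binEntropy_fifteen_sixteenths_sq : 0.369097 < binEntropy ((15 / 16) ^ 2) ∧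
    binEntropy ((15 / 16) ^ 2) < 0.369100 := by
  have h := binEntropy_ratio (a := 225) (b := 31) (by norm_num) (by norm_num)
  norm_num at h
  have h256 : log 256 = 8 * log 2 := by
    rw [show (256 : ℝ) = 2 ^ 8 by norm_num, log_pow]; norm_num
  have h225 : log 225 = 2 * log 3 + 2 * log 5 := by
    rw [show (225 : ℝ) = 3 ^ 2 * 5 ^ 2 by norm_num, log_mul (by norm_num) (by norm_num), log_pow,
      log_pow]
    norm_num
  norm_num
  rw [h, h225, h256]
  obtain ⟨a, b⟩ := log_two_enclosure
  obtain ⟨c, d⟩ := log_three_enclosure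
  obtain ⟨e, f⟩ := log_five_enclosure
  obtain ⟨k, l⟩ := log_thirtyone_enclosure
  constructor <;> linarith

/-! ### The diagonal inequality away from zero -/

/-- The bound 0.12942 just exceeds 4(2αk)k log 2 < 0.12941, the negative curvature of the dual term
on this range. All logarithms are replaced by tangents that are exact at x = 1/2. -/
theorem entropyDiagonalDeriv2_ge {A K x : ℝ} (hA : A ≤ 0.964395) (hK : 1.61902812 ≤ K)
    (h0 : 1 / 2 ≤ x) (h1 : x ≤ 3 / 4) : 0.12942 ≤ entropyDiagonalDeriv2 A K x := by
  have t1 := mul_le_mul_of_nonpos_right hA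
    (entropyDiagonalDeriv2_coeff_nonpos h0 (by linarith))
  have t2 := mul_le_mul_of_nonneg_right hK
    (entropyDiagonalDeriv2_coeff_nonneg h0 (by linarith))
  unfold entropyDiagonalDeriv2
  refine le_trans ?_ (add_le_add t1 t2)
  obtain ⟨L0, L1⟩ := log_two_enclosure
  obtain ⟨T0, T1⟩ := log_three_enclosure
  have l1 := log_le_of_scale (s := 1 / 2) (y := 1 - x) (by norm_num) (by linarith)
  have l3 := log_le_of_scale (s := 1 / 2) (y := x) (by norm_num) (by linarith)
  have l2 := neg_log_le_of_scale (s := 3 / 2) (y := 1 + x) (by norm_num) (by linarith)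
  rw [log_div (by norm_num) (by norm_num), log_one] at l1 l3
  rw [log_div (by norm_num) (by norm_num)] at l2
  rw [log_one_sub_sq (by linarith) (by linarith), log_pow]
  push_cast
  have hx1 : 0 < 1 - x := by linarith
  have hx2 : 0 < 1 + x := by linarith
  have hfac : 1 - x ^ 2 = (1 - x) * (1 + x) := by ring
  have key : 0 ≤ (1.309266 * (0.6931471 + 2 * x - 1) + 1.92879 * (0.405465 + 1) +
      0.619467 * (0.6931471 - 2 * x + 1) - 0.12942) * ((1 - x) * (1 + x)) -
      1.92879 * 1.5 * (1 - x) - 3.85758 + 1.61902812 * (1 + x) := by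
    nlinarith [mul_nonneg (sub_nonneg.2 h0) (sub_nonneg.2 h1),
      mul_nonneg (mul_nonneg (sub_nonneg.2 h0) (sub_nonneg.2 h1)) hx1.le]
  have hW : ((1 - x) * (1 + x)) * ((1 - x) * (1 + x))⁻¹ = 1 :=
    mul_inv_cancel₀ (mul_pos hx1 hx2).ne'
  have e : 3 / 2 / (1 + x) = 1.5 * (1 - x) * ((1 - x) * (1 + x))⁻¹ := by field_simp; norm_num
  have e2 : 1 / (1 - x) = (1 + x) * ((1 - x) * (1 + x))⁻¹ := by field_simp
  rw [e] at l2
  rw [hfac, e2, div_eq_mul_inv 4]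
  have key2 := mul_nonneg key (inv_nonneg.2 (mul_pos hx1 hx2).le)
  generalize ((1 - x) * (1 + x))⁻¹ = r at *
  have hE := congrArg ((1.309266 * (0.6931471 + 2 * x - 1) + 1.92879 * (0.405465 + 1) +
      0.619467 * (0.6931471 - 2 * x + 1) - 0.12942) * ·) hW
  simp only [mul_one] at hE
  linarith

/-- The added term is the curvature of x h(2x - 1), weighted by the lower bound 0.057645 for 2αk;
the right side stays just below 4(2αk)k log 2. Hence the diagonal is concave on this range. -/
theorem entropyDiagonalDeriv2_le {A K x : ℝ} (hA : 0.964391 ≤ A) (hK : K ≤ 1.61902832)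
    (h0 : 3 / 4 ≤ x) (h1 : x ≤ 15 / 16) :
    entropyDiagonalDeriv2 A K x +
      0.057645 * (4 * (log (2 - 2 * x) - log (2 * x - 1)) - 2 * x / ((2 * x - 1) * (1 - x))) ≤
      0.12937 := by
  have t1 := mul_le_mul_of_nonpos_right hA
    (entropyDiagonalDeriv2_coeff_nonpos (x := x) (by linarith) (by linarith))
  have t2 := mul_le_mul_of_nonneg_right hK
    (entropyDiagonalDeriv2_coeff_nonneg (x := x) (by linarith) (by linarith))
  unfold entropyDiagonalDeriv2
  refine le_trans (add_le_add_left (add_le_add t1 t2) _) ?_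
  obtain ⟨L0, L1⟩ := log_two_enclosure
  have l1 := neg_log_le_of_scale (s := 1 / 4) (y := 1 - x) (by norm_num) (by linarith)
  have l4 := neg_log_le_of_scale (s := 1 / 2) (y := 2 * x - 1) (by norm_num) (by linarith)
  have l2 := log_le_of_scale (s := 2) (y := 1 + x) (by norm_num) (by linarith)
  have l3 := log_ge_chord (x := x) (by linarith) (by linarith)
  have q : log 4 = 2 * log 2 := by
    rw [show (4 : ℝ) = 2 ^ 2 by norm_num, log_pow]; norm_num
  rw [log_div (by norm_num) (by norm_num), log_one, q] at l1
  rw [log_div (by norm_num) (by norm_num), log_one] at l4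
  have e5 : log (2 - 2 * x) = log 2 + log (1 - x) := by
    rw [← log_mul (by norm_num) (by linarith)]; congr 1; ring
  rw [log_one_sub_sq (by linarith) (by linarith), log_pow, e5]
  push_cast
  have hx1 : 0 < 1 - x := by linarith
  have hx2 : 0 < 1 + x := by linarith
  have hx3 : 0 < 2 * x - 1 := by linarith
  have hx4 : x * 2 - 1 ≠ 0 := by linarith
  have hfac : 1 - x ^ 2 = (1 - x) * (1 + x) := by ring
  have key : (1.07869464 * (-1 + 2 * 0.69314719) + 0.23058 * (-1 + 2 * 0.69314719) +
      1.928782 * (x / 2 - 1 / 2 + 0.69314719) + 0.61950736 * (2 * 0.69314719 * (1 - x)) - 0.12937) *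
        ((1 - x) * (1 + x) * (2 * x - 1)) +
      (1.07869464 / 4 + 1.61902832) * ((1 + x) * (2 * x - 1)) + 0.23058 / 2 * ((1 - x) * (1 + x)) -
      3.857564 * (2 * x - 1) - 0.11529 * x * (1 + x) ≤ 0 := by
    nlinarith [mul_nonneg (sub_nonneg.2 h0) (sub_nonneg.2 h1),
      mul_nonneg (mul_nonneg (sub_nonneg.2 h0) (sub_nonneg.2 h1)) (sub_nonneg.2 h0),
      mul_nonneg (mul_nonneg (sub_nonneg.2 h0) (sub_nonneg.2 h1)) (mul_nonneg (sub_nonneg.2 h0) (sub_nonneg.2 h1))]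
  set W := (1 - x) * (1 + x) * (2 * x - 1) with hWdef
  have hWpos : 0 < W := by positivity
  have hW : W * W⁻¹ = 1 := mul_inv_cancel₀ hWpos.ne'
  have e1 : 1 / (1 - x) = (1 + x) * (2 * x - 1) * W⁻¹ := by rw [hWdef]; field_simp
  have e2 : 1 / 4 / (1 - x) = (1 + x) * (2 * x - 1) / 4 * W⁻¹ := by rw [hWdef]; field_simp
  have e3 : 1 / 2 / (2 * x - 1) = (1 - x) * (1 + x) / 2 * W⁻¹ := by rw [hWdef]; field_simp
  have e4 : 4 / ((1 - x) * (1 + x)) = 4 * (2 * x - 1) * W⁻¹ := by rw [hWdef]; field_simp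
  have e6 : 2 * x / ((2 * x - 1) * (1 - x)) = 2 * x * (1 + x) * W⁻¹ := by rw [hWdef]; field_simp
  rw [e2] at l1
  rw [e3] at l4
  rw [hfac, e1, e4, e6]
  have key2 := mul_nonpos_of_nonpos_of_nonneg key (inv_nonneg.2 hWpos.le)
  have hE := congrArg ((1.07869464 * (-1 + 2 * 0.69314719) + 0.23058 * (-1 + 2 * 0.69314719) +
      1.928782 * (x / 2 - 1 / 2 + 0.69314719) + 0.61950736 * (2 * 0.69314719 * (1 - x)) - 0.12937) *
        ·) hW
  simp only [mul_one] at hE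
  have hLx : log 2 * (1 - x) ≤ 0.69314719 * (1 - x) := by
    apply mul_le_mul_of_nonneg_right _ hx1.le; linarith
  clear_value W
  generalize W⁻¹ = r at *
  linarith

theorem entropyDiagonalDeriv2_nonpos {A K x : ℝ} (hA : 0.964391 ≤ A) (hK : K ≤ 1.61902832)
    (h0 : 15 / 16 ≤ x) (h1 : x < 1) : entropyDiagonalDeriv2 A K x ≤ 0 := by
  have t1 := mul_le_mul_of_nonpos_right hA
    (entropyDiagonalDeriv2_coeff_nonpos (x := x) (by linarith) (by linarith))
  have t2 := mul_le_mul_of_nonneg_right hK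
    (entropyDiagonalDeriv2_coeff_nonneg (x := x) (by linarith) (by linarith))
  unfold entropyDiagonalDeriv2
  refine le_trans (add_le_add t1 t2) ?_
  obtain ⟨L0, L1⟩ := log_two_enclosure
  have l1 := neg_log_le_of_scale (s := 1 / 16) (y := 1 - x) (by norm_num) (by linarith)
  have l2 := log_le_of_scale (s := 2) (y := 1 + x) (by norm_num) (by linarith)
  have l3 := log_ge_chord (x := x) (by linarith) (by linarith)
  have q : log 16 = 4 * log 2 := by
    rw [show (16 : ℝ) = 2 ^ 4 by norm_num, log_pow]; norm_num
  rw [log_div (by norm_num) (by norm_num), log_one, q] at l1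
  rw [log_one_sub_sq (by linarith) (by linarith), log_pow]
  push_cast
  have hx1 : 0 < 1 - x := by linarith
  have hx2 : 0 < 1 + x := by linarith
  have hfac : 1 - x ^ 2 = (1 - x) * (1 + x) := by ring
  have key : (1.30927464 * (-1 + 4 * 0.69314719) + 1.928782 * (x / 2 - 1 / 2 + 0.69314719) +
      0.61950736 * (2 * 0.69314719 * (1 - x))) * ((1 - x) * (1 + x)) +
      (1.30927464 / 16 + 1.61902832) * (1 + x) - 3.857564 ≤ 0 := by
    nlinarith [mul_nonneg (sub_nonneg.2 h0) hx1.le]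
  set W := (1 - x) * (1 + x) with hWdef
  have hWpos : 0 < W := by positivity
  have hW : W * W⁻¹ = 1 := mul_inv_cancel₀ hWpos.ne'
  have e1 : 1 / (1 - x) = (1 + x) * W⁻¹ := by rw [hWdef]; field_simp
  have e2 : 1 / 16 / (1 - x) = (1 + x) / 16 * W⁻¹ := by rw [hWdef]; field_simp
  rw [e2] at l1
  rw [hfac, e1, div_eq_mul_inv 4]
  have key2 := mul_nonpos_of_nonpos_of_nonneg key (inv_nonneg.2 hWpos.le)
  have hE := congrArg ((1.30927464 * (-1 + 4 * 0.69314719) +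
      1.928782 * (x / 2 - 1 / 2 + 0.69314719) + 0.61950736 * (2 * 0.69314719 * (1 - x))) * ·) hW
  simp only [mul_one] at hE
  have hLx : log 2 * (1 - x) ≤ 0.69314719 * (1 - x) := by
    apply mul_le_mul_of_nonneg_right _ hx1.le; linarith
  clear_value W
  generalize W⁻¹ = r at *
  linarith

namespace CriticalParameters

variable {β k α : ℝ}

/-- Here φ is constantly log 2, and the diagonal is convex with a double zero at β ≈ 0.6705. -/
theorem diagonal_nonneg_of_mem_middle (h : CriticalParameters β k α) {x : ℝ} (hx0 : 1 / 2 ≤ x)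
    (hx1 : x ≤ 3 / 4) :
    0 ≤ entropyDiagonal (1 - α) (2 * k) x +
      2 * (2 * α * k) * (x * (log 2 - log 2 * k * x)) := by
  obtain ⟨c0, c1⟩ := h.weight_bounds
  obtain ⟨e0, e1⟩ := h.weight_mul_slope_bounds
  obtain ⟨L0, L1⟩ := log_two_enclosure
  have hβ0 := h.beta_gt
  have hβ1 := h.beta_lt
  set c := 2 * α * k with hc
  let f : ℝ → ℝ := fun x => entropyDiagonal (1 - α) (2 * k) x +
    2 * c * (x * (log 2 - log 2 * k * x))
  have quad : ∀ y : ℝ, HasDerivAt (fun x : ℝ => 2 * c * (x * (log 2 - log 2 * k * x)))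
      (2 * c * log 2 - 4 * (c * k) * log 2 * y) y := by
    intro y
    have hid := hasDerivAt_id' y
    convert! (hid.fun_mul ((hid.const_mul (log 2 * k)).const_sub (log 2))).const_mul (2 * c) using 1
    ring
  have quad2 : ∀ y : ℝ, HasDerivAt (fun y : ℝ => 2 * c * log 2 - 4 * (c * k) * log 2 * y)
      (-(4 * (c * k) * log 2)) y := by
    intro y
    convert! ((hasDerivAt_id' y).const_mul (4 * (c * k) * log 2)).const_sub (2 * c * log 2) using 1
    ring
  have hconv : ConvexOn ℝ (Set.Icc (1 / 2) (3 / 4)) f := by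
    refine convexOn_of_hasDerivWithinAt2_nonneg (convex_Icc _ _)
      (f' := fun y => entropyDiagonalDeriv (1 - α) (2 * k) y +
        (2 * c * log 2 - 4 * (c * k) * log 2 * y))
      (f'' := fun y => entropyDiagonalDeriv2 (1 - α) (2 * k) y + -(4 * (c * k) * log 2)) ?_ ?_ ?_ ?_
    · apply Continuous.continuousOn
      have := continuous_entropyDiagonal (1 - α) (2 * k)
      fun_prop
    · rw [interior_Icc]
      rintro y ⟨hy0, hy1⟩
      exact ((hasDerivAt_entropyDiagonal _ _ (by linarith) (by linarith)).add
        (quad y)).hasDerivWithinAt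
    · rw [interior_Icc]
      rintro y ⟨hy0, hy1⟩
      exact ((hasDerivAt_entropyDiagonalDeriv _ _ (by linarith) (by linarith)).add
        (quad2 y)).hasDerivWithinAt
    · rw [interior_Icc]
      rintro y ⟨hy0, hy1⟩
      have := entropyDiagonalDeriv2_ge (A := 1 - α) (K := 2 * k) (x := y)
        (by linarith [h.alpha_gt]) (by linarith [h.k_gt]) hy0.le hy1.le
      have : c * k * log 2 ≤ 0.046672 * 0.69314718057 :=
        mul_le_mul e1.le L1.le (by linarith) (by norm_num)
      linarith
  have hs := h.slope
  have hz : f β = 0 := by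
    have e : log 2 * f β = 0 := by
      -- By `slope` and `critical`, 2kβ h(β) = h(β²) and the dual term equals α h(β²), so the three
      -- terms cancel.
      simp only [f, entropyDiagonal, hc]
      have hcr := h.critical
      linear_combination (1 - α) * hcr + (-binEntropy β + 2 * α * log 2 -
        α * (2 * k * (log 2 * β) + (2 * log 2 - binEntropy β))) * hs
    exact (mul_eq_zero.1 e).resolve_left (by linarith)
  have hd : HasDerivAt f 0 β := by
    convert! (hasDerivAt_entropyDiagonal (1 - α) (2 * k) (x := β) (by linarith)
      (by linarith)).add (quad β) using 1
    rw [← h.tangent, entropyDiagonalDeriv, hc]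
    ring
  exact ConvexOn.nonneg_of_critical_zero hconv (x := β) ⟨by linarith, by linarith⟩ ⟨hx0, hx1⟩ hz hd

/-- A concave function is at least the smaller of its endpoint values. At 3/4 the two branches of φ
agree and the middle range applies; at 15/16 the value is numerical. -/
theorem diagonal_nonneg_of_mem_upper (h : CriticalParameters β k α) {x : ℝ} (hx0 : 3 / 4 ≤ x)
    (hx1 : x ≤ 15 / 16) :
    0 ≤ entropyDiagonal (1 - α) (2 * k) x +
      2 * (2 * α * k) * (x * ((log 2 + binEntropy (2 * x - 1)) / 2 - log 2 * k * x)) := by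
  have hmid := h.diagonal_nonneg_of_mem_middle (x := 3 / 4) (by norm_num) le_rfl
  obtain ⟨c0, c1⟩ := h.weight_bounds
  obtain ⟨e0, e1⟩ := h.weight_mul_slope_bounds
  obtain ⟨L0, L1⟩ := log_two_enclosure
  have hα0 := h.alpha_gt
  have hα1 := h.alpha_lt
  have hk0 := h.k_gt
  have hk1 := h.k_lt
  set c := 2 * α * k with hc
  let f : ℝ → ℝ := fun x => entropyDiagonal (1 - α) (2 * k) x +
    2 * c * (x * ((log 2 + binEntropy (2 * x - 1)) / 2 - log 2 * k * x))
  have hlin : ∀ y : ℝ, HasDerivAt (fun y : ℝ => 2 * y - 1) 2 y := by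
    intro y
    simpa using ((hasDerivAt_id' y).const_mul 2).sub_const 1
  have hlin2 : ∀ y : ℝ, HasDerivAt (fun y : ℝ => 2 - 2 * y) (-2) y := by
    intro y
    simpa using ((hasDerivAt_id' y).const_mul 2).const_sub 2
  have quad : ∀ y : ℝ, 1 / 2 < y → y < 1 →
      HasDerivAt (fun x : ℝ => 2 * c * (x * ((log 2 + binEntropy (2 * x - 1)) / 2 - log 2 * k * x)))
      (c * (log 2 + binEntropy (2 * y - 1) + 2 * (y * (log (2 - 2 * y) - log (2 * y - 1)))) -
        4 * (c * k) * log 2 * y) y := by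
    intro y hy0 hy1
    have hid := hasDerivAt_id' y
    have hb := HasDerivAt.comp (h := fun y : ℝ => 2 * y - 1) y
      (hasDerivAt_binEntropy (p := 2 * y - 1) (by linarith) (by linarith)) (hlin y)
    convert! (hid.fun_mul (((hb.const_add (log 2)).div_const 2).fun_sub
      (hid.const_mul (log 2 * k)))).const_mul (2 * c) using 1
    simp only [Function.comp]
    rw [show 1 - (2 * y - 1) = 2 - 2 * y by ring]
    ring
  have quad2 : ∀ y : ℝ, 1 / 2 < y → y < 1 → HasDerivAt (fun y : ℝ =>
      c * (log 2 + binEntropy (2 * y - 1) + 2 * (y * (log (2 - 2 * y) - log (2 * y - 1)))) -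
        4 * (c * k) * log 2 * y)
      (c * (4 * (log (2 - 2 * y) - log (2 * y - 1)) - 2 * y / ((2 * y - 1) * (1 - y))) -
        4 * (c * k) * log 2) y := by
    intro y hy0 hy1
    have hid := hasDerivAt_id' y
    have hb := HasDerivAt.comp (h := fun y : ℝ => 2 * y - 1) y
      (hasDerivAt_binEntropy (p := 2 * y - 1) (by linarith) (by linarith)) (hlin y)
    have n1 : 2 * y - 1 ≠ 0 := by linarith
    have n2 : 2 - 2 * y ≠ 0 := by linarith
    have n3 : 1 - y ≠ 0 := by linarith
    have n4 : y * 2 - 1 ≠ 0 := by linarith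
    have hl := ((hlin2 y).log n2).fun_sub ((hlin y).log n1)
    convert! (((hb.const_add (log 2)).fun_add ((hid.fun_mul hl).const_mul 2)).const_mul c).fun_sub
      (hid.const_mul (4 * (c * k) * log 2)) using 1
    rw [show 1 - (2 * y - 1) = 2 - 2 * y by ring]
    have : y * (-2 / (2 - 2 * y) - 2 / (2 * y - 1)) = - y / ((2 * y - 1) * (1 - y)) := by
      rw [show 2 - 2 * y = 2 * (1 - y) by ring]
      field_simp
      ring
    rw [this]
    ring
  have hconc : ConcaveOn ℝ (Set.Icc (3 / 4) (15 / 16)) f := by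
    refine concaveOn_of_hasDerivWithinAt2_nonpos (convex_Icc _ _)
      (f' := fun y => entropyDiagonalDeriv (1 - α) (2 * k) y +
        (c * (log 2 + binEntropy (2 * y - 1) + 2 * (y * (log (2 - 2 * y) - log (2 * y - 1)))) -
          4 * (c * k) * log 2 * y))
      (f'' := fun y => entropyDiagonalDeriv2 (1 - α) (2 * k) y +
        (c * (4 * (log (2 - 2 * y) - log (2 * y - 1)) - 2 * y / ((2 * y - 1) * (1 - y))) -
          4 * (c * k) * log 2)) ?_ ?_ ?_ ?_
    · apply Continuous.continuousOn
      have := continuous_entropyDiagonal (1 - α) (2 * k)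
      fun_prop
    · rw [interior_Icc]
      rintro y ⟨hy0, hy1⟩
      exact ((hasDerivAt_entropyDiagonal _ _ (by linarith) (by linarith)).add
        (quad y (by linarith) (by linarith))).hasDerivWithinAt
    · rw [interior_Icc]
      rintro y ⟨hy0, hy1⟩
      exact ((hasDerivAt_entropyDiagonalDeriv _ _ (by linarith) (by linarith)).add
        (quad2 y (by linarith) (by linarith))).hasDerivWithinAt
    · rw [interior_Icc]
      rintro y ⟨hy0, hy1⟩
      have t1 := entropyDiagonalDeriv2_le (A := 1 - α) (K := 2 * k) (x := y)
        (by linarith) (by linarith) hy0.le hy1.le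
      have t2 : 0.046663 * 0.69314718055 ≤ c * k * log 2 :=
        mul_le_mul e0.le L0.le (by norm_num) (by linarith)
      have t3 : 4 * (log (2 - 2 * y) - log (2 * y - 1)) - 2 * y / ((2 * y - 1) * (1 - y)) ≤ 0 := by
        have a : log (2 - 2 * y) ≤ log (2 * y - 1) := log_le_log (by linarith) (by linarith)
        have b : 0 ≤ 2 * y / ((2 * y - 1) * (1 - y)) :=
          div_nonneg (by linarith) (mul_nonneg (by linarith) (by linarith))
        linarith
      have t4 := mul_le_mul_of_nonpos_right c0.le t3
      linarith
  have hleft : 0 ≤ f (3 / 4) := by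
    simp only [f]
    rw [show (2 : ℝ) * (3 / 4) - 1 = 2⁻¹ by norm_num, binEntropy_two_inv]
    convert hmid using 4
    ring
  have hright : 0 ≤ f (15 / 16) := by
    simp only [f, entropyDiagonal]
    rw [show (2 : ℝ) * (15 / 16) - 1 = 7 / 8 by norm_num]
    obtain ⟨a0, a1⟩ := binEntropy_fifteen_sixteenths
    obtain ⟨b0, b1⟩ := binEntropy_fifteen_sixteenths_sq
    obtain ⟨d0, d1⟩ := binEntropy_seven_eighths
    have t1 : 0.964391 * 0.369097 ≤ (1 - α) * binEntropy ((15 / 16) ^ 2) :=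
      mul_le_mul (by linarith) b0.le (by norm_num) (by linarith)
    have t2 : k * binEntropy (15 / 16) ≤ 0.80951416 * 0.233793 :=
      mul_le_mul hk1.le a1.le (by linarith) (by norm_num)
    have t3 : c * k * log 2 ≤ 0.046672 * 0.69314718057 :=
      mul_le_mul e1.le L1.le (by linarith) (by norm_num)
    have t4 : 0.057645 * (0.69314718 + 0.376770) ≤ c * (log 2 + binEntropy (7 / 8)) :=
      mul_le_mul c0.le (by linarith) (by norm_num) (by linarith)
    linarith
  exact (le_min hleft hright).trans (hconc.min_le_of_mem_Icc ⟨by norm_num, by norm_num⟩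
    ⟨by norm_num, by norm_num⟩ ⟨hx0, hx1⟩)

/-- With the dual term cut off, the diagonal is concave, positive at 15/16 and zero at 1. -/
theorem entropyDiagonal_nonneg_of_ge (h : CriticalParameters β k α) {x : ℝ} (hx0 : 15 / 16 ≤ x)
    (hx1 : x ≤ 1) : 0 ≤ entropyDiagonal (1 - α) (2 * k) x := by
  have hα0 := h.alpha_gt
  have hα1 := h.alpha_lt
  have hk0 := h.k_gt
  have hk1 := h.k_lt
  have hconc : ConcaveOn ℝ (Set.Icc (15 / 16) 1) (entropyDiagonal (1 - α) (2 * k)) := by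
    refine concaveOn_of_hasDerivWithinAt2_nonpos (convex_Icc _ _)
      (continuous_entropyDiagonal _ _).continuousOn
      (f' := entropyDiagonalDeriv (1 - α) (2 * k))
      (f'' := entropyDiagonalDeriv2 (1 - α) (2 * k)) ?_ ?_ ?_
    all_goals
      rw [interior_Icc]
      rintro y ⟨hy0, hy1⟩
    · exact (hasDerivAt_entropyDiagonal _ _ (by linarith) (by linarith)).hasDerivWithinAt
    · exact (hasDerivAt_entropyDiagonalDeriv _ _ (by linarith) (by linarith)).hasDerivWithinAt
    · exact entropyDiagonalDeriv2_nonpos (by linarith) (by linarith) hy0.le hy1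
  have hleft : 0 ≤ entropyDiagonal (1 - α) (2 * k) (15 / 16) := by
    unfold entropyDiagonal
    obtain ⟨a0, a1⟩ := binEntropy_fifteen_sixteenths
    obtain ⟨b0, b1⟩ := binEntropy_fifteen_sixteenths_sq
    have t1 : 0.964391 * 0.369097 ≤ (1 - α) * binEntropy ((15 / 16) ^ 2) :=
      mul_le_mul (by linarith) b0.le (by norm_num) (by linarith)
    have t2 : k * binEntropy (15 / 16) ≤ 0.80951416 * 0.233793 :=
      mul_le_mul hk1.le a1.le (by linarith) (by norm_num)
    linarith
  have hright : 0 ≤ entropyDiagonal (1 - α) (2 * k) 1 := by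
    simp [entropyDiagonal]
  exact (le_min hleft hright).trans (hconc.min_le_of_mem_Icc ⟨by norm_num, by norm_num⟩
    ⟨by norm_num, by norm_num⟩ ⟨hx0, hx1⟩)

end CriticalParameters

/-! ### Superadditivity defect of the entropy of a disjunction -/

/-- One term of Gibbs' inequality, from log t ≤ t - 1 at t = m/a. -/
theorem negMulLog_le_reference {a m : ℝ} (ha : 0 ≤ a) (hm : 0 < m) :
    negMulLog a ≤ -(a * log m) + m - a := by
  rcases ha.eq_or_lt with rfl | ha
  · simp [hm.le]
  · have := log_le_sub_one_of_pos (div_pos hm ha)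
    rw [log_div hm.ne' ha.ne'] at this
    have h2 := mul_le_mul_of_nonneg_left this ha.le
    have h3 : a * (m / a - 1) = m - a := by field_simp
    rw [h3] at h2
    rw [negMulLog]
    linarith

/-- Comparing the conditional law of two independent bits given their disjunction with a reference
law bounds the entropy of the disjunction from below. -/
theorem binEntropy_or_ge {p q r₁ r₂ r₃ : ℝ} (hp0 : 0 ≤ p) (hp1 : p ≤ 1) (hq0 : 0 < q) (hq1 : q ≤ 1)
    (h1 : 0 < r₁) (h2 : 0 < r₂) (h3 : 0 < r₃) (hr : r₁ + r₂ + r₃ ≤ 1) :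
    binEntropy p + binEntropy q + p * (1 - q) * log r₁ + q * (1 - p) * log r₂ +
      p * q * log r₃ ≤ binEntropy (p + q - p * q) := by
  set z := p + q - p * q with hz
  have hz0 : 0 < z := by nlinarith
  -- The three outcomes with disjunction 1 have total mass z; each is compared with rᵢ z. Additivity
  -- of entropy for independent bits then isolates h(z).
  have a1 := negMulLog_le_reference (mul_nonneg hp0 (sub_nonneg.2 hq1)) (mul_pos h1 hz0)
  have a2 := negMulLog_le_reference (mul_nonneg hq0.le (sub_nonneg.2 hp1)) (mul_pos h2 hz0)
  have a3 := negMulLog_le_reference (mul_nonneg hp0 hq0.le) (mul_pos h3 hz0)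
  rw [log_mul h1.ne' hz0.ne'] at a1
  rw [log_mul h2.ne' hz0.ne'] at a2
  rw [log_mul h3.ne' hz0.ne'] at a3
  have e := negMulLog_mul (1 - p) (1 - q)
  have hz1 : 1 - z = (1 - p) * (1 - q) := by rw [hz]; ring
  have b1 : binEntropy z = negMulLog z + negMulLog ((1 - p) * (1 - q)) := by
    rw [binEntropy_eq_negMulLog_add_negMulLog_one_sub, hz1]
  rw [negMulLog_mul] at a1 a2 a3
  have bz : negMulLog z = -(z * log z) := by rw [negMulLog]; ring
  rw [b1, e, bz, binEntropy_eq_negMulLog_add_negMulLog_one_sub p,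
    binEntropy_eq_negMulLog_add_negMulLog_one_sub q]
  have hs := mul_le_mul_of_nonneg_right hr hz0.le
  rw [hz] at *
  linarith

/-! ### Entropies at dyadic points -/

theorem binEntropy_one_div_thirtytwo : 0.139060 < binEntropy (1 / 32) ∧
    binEntropy (1 / 32) < 0.139061 := by
  have h := binEntropy_ratio (a := 1) (b := 31) (by norm_num) (by norm_num)
  norm_num at h
  have hn : log 32 = 5 * log 2 := by
    rw [show (32 : ℝ) = 2 ^ 5 by norm_num, log_pow]; norm_num
  rw [h, hn]
  obtain ⟨a, b⟩ := log_two_enclosure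
  obtain ⟨e, f⟩ := log_thirtyone_enclosure
  constructor <;> linarith

theorem binEntropy_three_div_sixtyfour : 0.189208 < binEntropy (3 / 64) ∧
    binEntropy (3 / 64) < 0.189210 := by
  have h := binEntropy_ratio (a := 3) (b := 61) (by norm_num) (by norm_num)
  norm_num at h
  have hn : log 64 = 6 * log 2 := by
    rw [show (64 : ℝ) = 2 ^ 6 by norm_num, log_pow]; norm_num
  rw [h, hn]
  obtain ⟨a, b⟩ := log_two_enclosure
  obtain ⟨c, d⟩ := log_three_enclosure
  obtain ⟨e, f⟩ := log_sixtyone_enclosure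
  constructor <;> linarith

theorem binEntropy_one_div_sixteen : 0.233791 < binEntropy (1 / 16) ∧
    binEntropy (1 / 16) < 0.233793 := by
  rw [← binEntropy_one_sub, show (1 : ℝ) - 1 / 16 = 15 / 16 by norm_num]
  obtain ⟨a, b⟩ := binEntropy_fifteen_sixteenths
  constructor <;> linarith

theorem binEntropy_three_div_thirtytwo : 0.311128 < binEntropy (3 / 32) ∧
    binEntropy (3 / 32) < 0.311130 := by
  have h := binEntropy_ratio (a := 3) (b := 29) (by norm_num) (by norm_num)
  norm_num at h
  have hn : log 32 = 5 * log 2 := by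
    rw [show (32 : ℝ) = 2 ^ 5 by norm_num, log_pow]; norm_num
  rw [h, hn]
  obtain ⟨a, b⟩ := log_two_enclosure
  obtain ⟨c, d⟩ := log_three_enclosure
  obtain ⟨e, f⟩ := log_twentynine_enclosure
  constructor <;> linarith

theorem binEntropy_one_div_eight : 0.376769 < binEntropy (1 / 8) ∧
    binEntropy (1 / 8) < 0.376771 := by
  rw [← binEntropy_one_sub, show (1 : ℝ) - 1 / 8 = 7 / 8 by norm_num]
  obtain ⟨a, b⟩ := binEntropy_seven_eighths
  constructor <;> linarith

theorem binEntropy_three_div_sixteen : 0.482577 < binEntropy (3 / 16) ∧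
    binEntropy (3 / 16) < 0.482578 := by
  have h := binEntropy_ratio (a := 3) (b := 13) (by norm_num) (by norm_num)
  norm_num at h
  have hn : log 16 = 4 * log 2 := by
    rw [show (16 : ℝ) = 2 ^ 4 by norm_num, log_pow]; norm_num
  rw [h, hn]
  obtain ⟨a, b⟩ := log_two_enclosure
  obtain ⟨c, d⟩ := log_three_enclosure
  obtain ⟨e, f⟩ := log_thirteen_enclosure
  constructor <;> linarith

/-! ### The mixed inequality -/

/-- Lower bound for the kernel at `(1 - p, 1 - q)` in terms of logarithms `l` of a reference law. -/
noncomputable def cornerBound (α k c l₁ l₂ l₃ p q : ℝ) : ℝ :=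
  (1 - α) * (binEntropy p + binEntropy q + p * (1 - q) * l₁ + q * (1 - p) * l₂ + p * q * l₃) -
    k * ((1 - p) * binEntropy q + (1 - q) * binEntropy p) +
    c * (1 - q) * ((log 2 + binEntropy (2 * p)) / 2 - log 2 * k * (1 - p))

theorem binEntropy_ge_chord {u v s : ℝ} (hu : 0 ≤ u) (hv : 0 ≤ v) (hu1 : u ≤ 1) (hv1 : v ≤ 1)
    (hs : 0 ≤ s) (hs1 : s ≤ 1) :
    (1 - s) * binEntropy u + s * binEntropy v ≤ binEntropy ((1 - s) * u + s * v) := by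
  simpa using strictConcave_binEntropy.concaveOn.2 ⟨hu, hu1⟩ ⟨hv, hv1⟩ (sub_nonneg.2 hs1) hs
    (by ring)

theorem exists_convex_combination {a b x : ℝ} (h0 : a ≤ x) (h1 : x ≤ b) :
    ∃ s, 0 ≤ s ∧ s ≤ 1 ∧ x = (1 - s) * a + s * b := by
  rcases h0.eq_or_lt with rfl | h
  · exact ⟨0, le_rfl, zero_le_one, by ring⟩
  · have hab : 0 < b - a := by linarith
    refine ⟨(x - a) / (b - a), div_nonneg (by linarith) hab.le, ?_, ?_⟩
    · rw [div_le_one hab]; linarith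
    · field_simp; ring

/-- The corner bound is concave in each variable, so it is nonnegative on a rectangle as soon as
it is nonnegative at the corners. -/
theorem cornerBound_nonneg_of_corners {α k c l₁ l₂ l₃ p₀ p₁ q₀ q₁ p q : ℝ} (hαk : k ≤ 1 - α)
    (hk : 0 ≤ k) (hc : 0 ≤ c) (hp₀ : 0 ≤ p₀) (hp₁ : p₁ ≤ 1 / 2) (hq₀ : 0 ≤ q₀) (hq₁ : q₁ ≤ 1)
    (h00 : 0 ≤ cornerBound α k c l₁ l₂ l₃ p₀ q₀) (h01 : 0 ≤ cornerBound α k c l₁ l₂ l₃ p₀ q₁)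
    (h10 : 0 ≤ cornerBound α k c l₁ l₂ l₃ p₁ q₀) (h11 : 0 ≤ cornerBound α k c l₁ l₂ l₃ p₁ q₁)
    (hp : p₀ ≤ p) (hp' : p ≤ p₁) (hq : q₀ ≤ q) (hq' : q ≤ q₁) :
    0 ≤ cornerBound α k c l₁ l₂ l₃ p q := by
  have hP : ∀ q', 0 ≤ q' → q' ≤ 1 → 0 ≤ cornerBound α k c l₁ l₂ l₃ p₀ q' →
      0 ≤ cornerBound α k c l₁ l₂ l₃ p₁ q' → 0 ≤ cornerBound α k c l₁ l₂ l₃ p q' := by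
    intro q' hq0 hq1 u v
    obtain ⟨s, hs0, hs1, rfl⟩ := exists_convex_combination hp hp'
    have e1 := binEntropy_ge_chord hp₀ (by linarith : 0 ≤ p₁) (by linarith) (by linarith) hs0 hs1
    have e2 := binEntropy_ge_chord (u := 2 * p₀) (v := 2 * p₁) (by linarith) (by linarith)
      (by linarith) (by linarith) hs0 hs1
    rw [show (1 - s) * (2 * p₀) + s * (2 * p₁) = 2 * ((1 - s) * p₀ + s * p₁) by ring] at e2
    -- Concavity in p rests on this net coefficient of h(p), nonnegative since k ≤ 1 - α.
    have c1 : 0 ≤ (1 - α) - k * (1 - q') := by nlinarith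
    have c2 : 0 ≤ c * (1 - q') / 2 :=
      div_nonneg (mul_nonneg hc (by linarith)) zero_le_two
    have m1 := mul_le_mul_of_nonneg_left e1 c1
    have m2 := mul_le_mul_of_nonneg_left e2 c2
    have u' := mul_nonneg (sub_nonneg.2 hs1) u
    have v' := mul_nonneg hs0 v
    unfold cornerBound at *
    linarith
  have g0 := hP q₀ hq₀ (by linarith) h00 h10
  have g1 := hP q₁ (by linarith) hq₁ h01 h11
  obtain ⟨s, hs0, hs1, rfl⟩ := exists_convex_combination hq hq'
  have e1 := binEntropy_ge_chord hq₀ (by linarith : 0 ≤ q₁) (by linarith) (by linarith) hs0 hs1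
  have c1 : 0 ≤ (1 - α) - k * (1 - p) := by nlinarith
  have m1 := mul_le_mul_of_nonneg_left e1 c1
  have u' := mul_nonneg (sub_nonneg.2 hs1) g0
  have v' := mul_nonneg hs0 g1
  unfold cornerBound at *
  linarith

/-- Interval evaluation of the corner bound. -/
theorem cornerBound_nonneg_of_enclosures {α k c l₁ l₂ l₃ m₁ m₂ m₃ p q a a' b b' d : ℝ}
    (hα1 : α ≤ 0.035609) (hk0 : 0 ≤ k) (hk : k ≤ 0.80951416)
    (hc : 0.057645 ≤ c) (hck : c * k ≤ 0.046672)
    (hp0 : 0 ≤ p) (hp1 : p ≤ 1) (hq0 : 0 ≤ q) (hq1 : q ≤ 1)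
    (hp : a ≤ binEntropy p ∧ binEntropy p ≤ a') (hq : b ≤ binEntropy q ∧ binEntropy q ≤ b')
    (h2p : d ≤ binEntropy (2 * p)) (hd : 0 ≤ d) (hm₁ : m₁ ≤ l₁) (hm₂ : m₂ ≤ l₂) (hm₃ : m₃ ≤ l₃)
    (hpos : 0 ≤ a + b + p * (1 - q) * m₁ + q * (1 - p) * m₂ + p * q * m₃)
    (h : 0 ≤ 0.964391 * (a + b + p * (1 - q) * m₁ + q * (1 - p) * m₂ + p * q * m₃) -
      0.80951416 * ((1 - p) * b' + (1 - q) * a') +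
      (1 - q) * (0.057645 * ((0.69314718 + d) / 2) - 0.046672 * 0.69314719 * (1 - p))) :
    0 ≤ cornerBound α k c l₁ l₂ l₃ p q := by
  obtain ⟨L0, L1⟩ := log_two_enclosure
  have hp1' := sub_nonneg.2 hp1
  have hq1' := sub_nonneg.2 hq1
  have w₁ := mul_le_mul_of_nonneg_left hm₁ (mul_nonneg hp0 hq1')
  have w₂ := mul_le_mul_of_nonneg_left hm₂ (mul_nonneg hq0 hp1')
  have w₃ := mul_le_mul_of_nonneg_left hm₃ (mul_nonneg hp0 hq0)
  have t1 : 0.964391 * (a + b + p * (1 - q) * m₁ + q * (1 - p) * m₂ + p * q * m₃) ≤ (1 - α) *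
      (binEntropy p + binEntropy q + p * (1 - q) * l₁ + q * (1 - p) * l₂ + p * q * l₃) :=
    mul_le_mul (by linarith) (by linarith [hp.1, hq.1]) hpos (by linarith)
  have hpe := binEntropy_nonneg hp0 hp1
  have hqe := binEntropy_nonneg hq0 hq1
  have t2 : k * ((1 - p) * binEntropy q + (1 - q) * binEntropy p) ≤
      0.80951416 * ((1 - p) * b' + (1 - q) * a') :=
    mul_le_mul hk (add_le_add (mul_le_mul_of_nonneg_left hq.2 hp1')
      (mul_le_mul_of_nonneg_left hp.2 hq1')) (by positivity) (by norm_num)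
  have t3 : 0.057645 * ((0.69314718 + d) / 2) ≤ c * ((log 2 + binEntropy (2 * p)) / 2) :=
    mul_le_mul hc (by linarith) (by linarith) (by linarith)
  have hck0 : 0 ≤ c * k := mul_nonneg (by linarith) hk0
  have t4 : c * k * log 2 ≤ 0.046672 * 0.69314719 :=
    mul_le_mul hck (by linarith) (by linarith) (by norm_num)
  have t5 := mul_le_mul_of_nonneg_right t4 hp1'
  have t6 : 0.057645 * ((0.69314718 + d) / 2) - 0.046672 * 0.69314719 * (1 - p) ≤
      c * ((log 2 + binEntropy (2 * p)) / 2) - c * k * log 2 * (1 - p) := by linarith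
  have t7 := mul_le_mul_of_nonneg_left t6 hq1'
  unfold cornerBound
  linarith

theorem binEntropy_half_enclosure :
    0.69314718 ≤ binEntropy (1 / 2) ∧ binEntropy (1 / 2) ≤ 0.69314719 := by
  obtain ⟨a, b⟩ := log_two_enclosure
  rw [one_div, binEntropy_two_inv]
  constructor <;> linarith

/-! ### Five rectangles covering 0 ≤ p ≤ 1/16 ≤ q ≤ 1/2 -/

/-- The reference law (12, 32, 1)/45 is the conditional law of independent bits with biases 1/33 and
1/13, given that their disjunction is 1; there `binEntropy_or_ge` is an equality. The other
rectangles use the pairs (1/26, 1/17), (2/37, 1/14), (2/37, 1/10) and (1/26, 2/11). -/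
theorem kernel_rectangle_narrow_bottom {α k c p q : ℝ}
    (hα1 : α ≤ 0.035609) (hk0 : 0 ≤ k) (hk : k ≤ 0.80951416)
    (hc : 0.057645 ≤ c) (hck : c * k ≤ 0.046672)
    (hp0 : 0 ≤ p) (hp1 : p ≤ 1/32) (hq0 : 1/16 ≤ q) (hq1 : q ≤ 3/16) :
    0 ≤ cornerBound α k c (log (12 / 45)) (log (32 / 45)) (log (1 / 45)) p q := by
  have h2 := log_two_enclosure
  have h3 := log_three_enclosure
  have h5 := log_five_enclosure
  have m1 : (-1.321757 : ℝ) ≤ log (12 / 45) := by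
    rw [log_div (by norm_num) (by norm_num), show (12 : ℝ) = 2 ^ 2 * 3 by norm_num,
      log_mul (by norm_num) (by norm_num),
      log_pow,
      show (45 : ℝ) = 3 ^ 2 * 5 by norm_num,
      log_mul (by norm_num) (by norm_num),
      log_pow]
    norm_num
    linarith [h2.1, h2.2, h3.1, h3.2, h5.1, h5.2]
  have m2 : (-0.340928 : ℝ) ≤ log (32 / 45) := by
    rw [log_div (by norm_num) (by norm_num), show (32 : ℝ) = 2 ^ 5 by norm_num,
      log_pow,
      show (45 : ℝ) = 3 ^ 2 * 5 by norm_num,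
      log_mul (by norm_num) (by norm_num),
      log_pow]
    norm_num
    linarith [h2.1, h2.2, h3.1, h3.2, h5.1, h5.2]
  have m3 : (-3.806663 : ℝ) ≤ log (1 / 45) := by
    rw [log_div (by norm_num) (by norm_num), log_one,
      show (45 : ℝ) = 3 ^ 2 * 5 by norm_num,
      log_mul (by norm_num) (by norm_num),
      log_pow]
    norm_num
    linarith [h3.1, h3.2, h5.1, h5.2]
  refine cornerBound_nonneg_of_corners (p₀ := 0) (p₁ := 1/32) (q₀ := 1/16) (q₁ := 3/16)
    (by linarith) hk0 (by linarith) (by norm_num) (by norm_num) (by norm_num) (by norm_num)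
    ?_ ?_ ?_ ?_ hp0 hp1 hq0 hq1
  · exact cornerBound_nonneg_of_enclosures (a := 0) (a' := 0) (b := 0.233791) (b' := 0.233793)
      (d := 0) hα1 hk0 hk hc hck (by norm_num) (by norm_num) (by norm_num) (by norm_num)
      ⟨by simp, by simp⟩ ⟨binEntropy_one_div_sixteen.1.le, binEntropy_one_div_sixteen.2.le⟩
      (by simp) (by norm_num) m1 m2 m3 (by norm_num) (by norm_num)
  · exact cornerBound_nonneg_of_enclosures (a := 0) (a' := 0) (b := 0.482577) (b' := 0.482578)
      (d := 0) hα1 hk0 hk hc hck (by norm_num) (by norm_num) (by norm_num) (by norm_num)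
      ⟨by simp, by simp⟩ ⟨binEntropy_three_div_sixteen.1.le, binEntropy_three_div_sixteen.2.le⟩
      (by simp) (by norm_num) m1 m2 m3 (by norm_num) (by norm_num)
  · exact cornerBound_nonneg_of_enclosures (a := 0.139060) (a' := 0.139061)
      (b := 0.233791) (b' := 0.233793)
      (d := 0.233791) hα1 hk0 hk hc hck (by norm_num) (by norm_num) (by norm_num) (by norm_num)
      ⟨binEntropy_one_div_thirtytwo.1.le, binEntropy_one_div_thirtytwo.2.le⟩
      ⟨binEntropy_one_div_sixteen.1.le, binEntropy_one_div_sixteen.2.le⟩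
      (by norm_num; linarith [binEntropy_one_div_sixteen.1])
      (by norm_num) m1 m2 m3 (by norm_num) (by norm_num)
  · exact cornerBound_nonneg_of_enclosures (a := 0.139060) (a' := 0.139061)
      (b := 0.482577) (b' := 0.482578)
      (d := 0.233791) hα1 hk0 hk hc hck (by norm_num) (by norm_num) (by norm_num) (by norm_num)
      ⟨binEntropy_one_div_thirtytwo.1.le, binEntropy_one_div_thirtytwo.2.le⟩
      ⟨binEntropy_three_div_sixteen.1.le, binEntropy_three_div_sixteen.2.le⟩
      (by norm_num; linarith [binEntropy_one_div_sixteen.1])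
      (by norm_num) m1 m2 m3 (by norm_num) (by norm_num)

theorem kernel_rectangle_narrow_middle {α k c p q : ℝ}
    (hα1 : α ≤ 0.035609) (hk0 : 0 ≤ k) (hk : k ≤ 0.80951416)
    (hc : 0.057645 ≤ c) (hck : c * k ≤ 0.046672)
    (hp0 : 1/32 ≤ p) (hp1 : p ≤ 3/64) (hq0 : 1/16 ≤ q) (hq1 : q ≤ 3/32) :
    0 ≤ cornerBound α k c (log (16 / 42)) (log (25 / 42)) (log (1 / 42)) p q := by
  have h2 := log_two_enclosure
  have h3 := log_three_enclosure
  have h5 := log_five_enclosure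
  have h7 := log_seven_enclosure
  have m1 : (-0.965082 : ℝ) ≤ log (16 / 42) := by
    rw [log_div (by norm_num) (by norm_num), show (16 : ℝ) = 2 ^ 4 by norm_num,
      log_pow,
      show (42 : ℝ) = 2 * 3 * 7 by norm_num,
      log_mul (by norm_num) (by norm_num),
      log_mul (by norm_num) (by norm_num)]
    norm_num
    linarith [h2.1, h2.2, h3.1, h3.2, h7.1, h7.2]
  have m2 : (-0.518795 : ℝ) ≤ log (25 / 42) := by
    rw [log_div (by norm_num) (by norm_num), show (25 : ℝ) = 5 ^ 2 by norm_num,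
      log_pow,
      show (42 : ℝ) = 2 * 3 * 7 by norm_num,
      log_mul (by norm_num) (by norm_num),
      log_mul (by norm_num) (by norm_num)]
    norm_num
    linarith [h2.1, h2.2, h3.1, h3.2, h5.1, h5.2, h7.1, h7.2]
  have m3 : (-3.737671 : ℝ) ≤ log (1 / 42) := by
    rw [log_div (by norm_num) (by norm_num), log_one,
      show (42 : ℝ) = 2 * 3 * 7 by norm_num,
      log_mul (by norm_num) (by norm_num),
      log_mul (by norm_num) (by norm_num)]
    norm_num
    linarith [h2.1, h2.2, h3.1, h3.2, h7.1, h7.2]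
  refine cornerBound_nonneg_of_corners (p₀ := 1/32) (p₁ := 3/64) (q₀ := 1/16) (q₁ := 3/32)
    (by linarith) hk0 (by linarith) (by norm_num) (by norm_num) (by norm_num) (by norm_num)
    ?_ ?_ ?_ ?_ hp0 hp1 hq0 hq1
  · exact cornerBound_nonneg_of_enclosures (a := 0.139060) (a' := 0.139061)
      (b := 0.233791) (b' := 0.233793)
      (d := 0.233791) hα1 hk0 hk hc hck (by norm_num) (by norm_num) (by norm_num) (by norm_num)
      ⟨binEntropy_one_div_thirtytwo.1.le, binEntropy_one_div_thirtytwo.2.le⟩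
      ⟨binEntropy_one_div_sixteen.1.le, binEntropy_one_div_sixteen.2.le⟩
      (by norm_num; linarith [binEntropy_one_div_sixteen.1])
      (by norm_num) m1 m2 m3 (by norm_num) (by norm_num)
  · exact cornerBound_nonneg_of_enclosures (a := 0.139060) (a' := 0.139061)
      (b := 0.311128) (b' := 0.311130)
      (d := 0.233791) hα1 hk0 hk hc hck (by norm_num) (by norm_num) (by norm_num) (by norm_num)
      ⟨binEntropy_one_div_thirtytwo.1.le, binEntropy_one_div_thirtytwo.2.le⟩
      ⟨binEntropy_three_div_thirtytwo.1.le, binEntropy_three_div_thirtytwo.2.le⟩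
      (by norm_num; linarith [binEntropy_one_div_sixteen.1])
      (by norm_num) m1 m2 m3 (by norm_num) (by norm_num)
  · exact cornerBound_nonneg_of_enclosures (a := 0.189208) (a' := 0.189210)
      (b := 0.233791) (b' := 0.233793)
      (d := 0.311128) hα1 hk0 hk hc hck (by norm_num) (by norm_num) (by norm_num) (by norm_num)
      ⟨binEntropy_three_div_sixtyfour.1.le, binEntropy_three_div_sixtyfour.2.le⟩
      ⟨binEntropy_one_div_sixteen.1.le, binEntropy_one_div_sixteen.2.le⟩
      (by norm_num; linarith [binEntropy_three_div_thirtytwo.1])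
      (by norm_num) m1 m2 m3 (by norm_num) (by norm_num)
  · exact cornerBound_nonneg_of_enclosures (a := 0.189208) (a' := 0.189210)
      (b := 0.311128) (b' := 0.311130)
      (d := 0.311128) hα1 hk0 hk hc hck (by norm_num) (by norm_num) (by norm_num) (by norm_num)
      ⟨binEntropy_three_div_sixtyfour.1.le, binEntropy_three_div_sixtyfour.2.le⟩
      ⟨binEntropy_three_div_thirtytwo.1.le, binEntropy_three_div_thirtytwo.2.le⟩
      (by norm_num; linarith [binEntropy_three_div_thirtytwo.1])
      (by norm_num) m1 m2 m3 (by norm_num) (by norm_num)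

theorem kernel_rectangle_narrow_top {α k c p q : ℝ}
    (hα1 : α ≤ 0.035609) (hk0 : 0 ≤ k) (hk : k ≤ 0.80951416)
    (hc : 0.057645 ≤ c) (hck : c * k ≤ 0.046672)
    (hp0 : 3/64 ≤ p) (hp1 : p ≤ 1/16) (hq0 : 1/16 ≤ q) (hq1 : q ≤ 3/32) :
    0 ≤ cornerBound α k c (log (26 / 63)) (log (35 / 63)) (log (2 / 63)) p q := by
  have h2 := log_two_enclosure
  have h3 := log_three_enclosure
  have h5 := log_five_enclosure
  have h7 := log_seven_enclosure
  have h13 := log_thirteen_enclosure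
  have m1 : (-0.885039 : ℝ) ≤ log (26 / 63) := by
    rw [log_div (by norm_num) (by norm_num), show (26 : ℝ) = 2 * 13 by norm_num,
      log_mul (by norm_num) (by norm_num),
      show (63 : ℝ) = 3 ^ 2 * 7 by norm_num,
      log_mul (by norm_num) (by norm_num),
      log_pow]
    norm_num
    linarith [h2.1, h2.2, h3.1, h3.2, h7.1, h7.2, h13.1, h13.2]
  have m2 : (-0.587788 : ℝ) ≤ log (35 / 63) := by
    rw [log_div (by norm_num) (by norm_num), show (35 : ℝ) = 5 * 7 by norm_num,
      log_mul (by norm_num) (by norm_num),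
      show (63 : ℝ) = 3 ^ 2 * 7 by norm_num,
      log_mul (by norm_num) (by norm_num),
      log_pow]
    norm_num
    linarith [h3.1, h3.2, h5.1, h5.2, h7.1, h7.2]
  have m3 : (-3.449989 : ℝ) ≤ log (2 / 63) := by
    rw [log_div (by norm_num) (by norm_num), show (63 : ℝ) = 3 ^ 2 * 7 by norm_num,
      log_mul (by norm_num) (by norm_num),
      log_pow]
    norm_num
    linarith [h2.1, h2.2, h3.1, h3.2, h7.1, h7.2]
  refine cornerBound_nonneg_of_corners (p₀ := 3/64) (p₁ := 1/16) (q₀ := 1/16) (q₁ := 3/32)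
    (by linarith) hk0 (by linarith) (by norm_num) (by norm_num) (by norm_num) (by norm_num)
    ?_ ?_ ?_ ?_ hp0 hp1 hq0 hq1
  · exact cornerBound_nonneg_of_enclosures (a := 0.189208) (a' := 0.189210)
      (b := 0.233791) (b' := 0.233793)
      (d := 0.311128) hα1 hk0 hk hc hck (by norm_num) (by norm_num) (by norm_num) (by norm_num)
      ⟨binEntropy_three_div_sixtyfour.1.le, binEntropy_three_div_sixtyfour.2.le⟩
      ⟨binEntropy_one_div_sixteen.1.le, binEntropy_one_div_sixteen.2.le⟩
      (by norm_num; linarith [binEntropy_three_div_thirtytwo.1])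
      (by norm_num) m1 m2 m3 (by norm_num) (by norm_num)
  · exact cornerBound_nonneg_of_enclosures (a := 0.189208) (a' := 0.189210)
      (b := 0.311128) (b' := 0.311130)
      (d := 0.311128) hα1 hk0 hk hc hck (by norm_num) (by norm_num) (by norm_num) (by norm_num)
      ⟨binEntropy_three_div_sixtyfour.1.le, binEntropy_three_div_sixtyfour.2.le⟩
      ⟨binEntropy_three_div_thirtytwo.1.le, binEntropy_three_div_thirtytwo.2.le⟩
      (by norm_num; linarith [binEntropy_three_div_thirtytwo.1])
      (by norm_num) m1 m2 m3 (by norm_num) (by norm_num)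
  · exact cornerBound_nonneg_of_enclosures (a := 0.233791) (a' := 0.233793)
      (b := 0.233791) (b' := 0.233793)
      (d := 0.376769) hα1 hk0 hk hc hck (by norm_num) (by norm_num) (by norm_num) (by norm_num)
      ⟨binEntropy_one_div_sixteen.1.le, binEntropy_one_div_sixteen.2.le⟩
      ⟨binEntropy_one_div_sixteen.1.le, binEntropy_one_div_sixteen.2.le⟩
      (by norm_num; linarith [binEntropy_one_div_eight.1])
      (by norm_num) m1 m2 m3 (by norm_num) (by norm_num)
  · exact cornerBound_nonneg_of_enclosures (a := 0.233791) (a' := 0.233793)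
      (b := 0.311128) (b' := 0.311130)
      (d := 0.376769) hα1 hk0 hk hc hck (by norm_num) (by norm_num) (by norm_num) (by norm_num)
      ⟨binEntropy_one_div_sixteen.1.le, binEntropy_one_div_sixteen.2.le⟩
      ⟨binEntropy_three_div_thirtytwo.1.le, binEntropy_three_div_thirtytwo.2.le⟩
      (by norm_num; linarith [binEntropy_one_div_eight.1])
      (by norm_num) m1 m2 m3 (by norm_num) (by norm_num)

theorem kernel_rectangle_wide_middle {α k c p q : ℝ}
    (hα1 : α ≤ 0.035609) (hk0 : 0 ≤ k) (hk : k ≤ 0.80951416)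
    (hc : 0.057645 ≤ c) (hck : c * k ≤ 0.046672)
    (hp0 : 1/32 ≤ p) (hp1 : p ≤ 1/16) (hq0 : 3/32 ≤ q) (hq1 : q ≤ 3/16) :
    0 ≤ cornerBound α k c (log (18 / 55)) (log (35 / 55)) (log (2 / 55)) p q := by
  have h2 := log_two_enclosure
  have h3 := log_three_enclosure
  have h5 := log_five_enclosure
  have h7 := log_seven_enclosure
  have h11 := log_eleven_enclosure
  have m1 : (-1.116962 : ℝ) ≤ log (18 / 55) := by
    rw [log_div (by norm_num) (by norm_num), show (18 : ℝ) = 2 * 3 ^ 2 by norm_num,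
      log_mul (by norm_num) (by norm_num),
      log_pow,
      show (55 : ℝ) = 5 * 11 by norm_num,
      log_mul (by norm_num) (by norm_num)]
    norm_num
    linarith [h2.1, h2.2, h3.1, h3.2, h5.1, h5.2, h11.1, h11.2]
  have m2 : (-0.451986 : ℝ) ≤ log (35 / 55) := by
    rw [log_div (by norm_num) (by norm_num), show (35 : ℝ) = 5 * 7 by norm_num,
      log_mul (by norm_num) (by norm_num),
      show (55 : ℝ) = 5 * 11 by norm_num,
      log_mul (by norm_num) (by norm_num)]
    norm_num
    linarith [h5.1, h5.2, h7.1, h7.2, h11.1, h11.2]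
  have m3 : (-3.314187 : ℝ) ≤ log (2 / 55) := by
    rw [log_div (by norm_num) (by norm_num), show (55 : ℝ) = 5 * 11 by norm_num,
      log_mul (by norm_num) (by norm_num)]
    norm_num
    linarith [h2.1, h2.2, h5.1, h5.2, h11.1, h11.2]
  refine cornerBound_nonneg_of_corners (p₀ := 1/32) (p₁ := 1/16) (q₀ := 3/32) (q₁ := 3/16)
    (by linarith) hk0 (by linarith) (by norm_num) (by norm_num) (by norm_num) (by norm_num)
    ?_ ?_ ?_ ?_ hp0 hp1 hq0 hq1
  · exact cornerBound_nonneg_of_enclosures (a := 0.139060) (a' := 0.139061)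
      (b := 0.311128) (b' := 0.311130)
      (d := 0.233791) hα1 hk0 hk hc hck (by norm_num) (by norm_num) (by norm_num) (by norm_num)
      ⟨binEntropy_one_div_thirtytwo.1.le, binEntropy_one_div_thirtytwo.2.le⟩
      ⟨binEntropy_three_div_thirtytwo.1.le, binEntropy_three_div_thirtytwo.2.le⟩
      (by norm_num; linarith [binEntropy_one_div_sixteen.1])
      (by norm_num) m1 m2 m3 (by norm_num) (by norm_num)
  · exact cornerBound_nonneg_of_enclosures (a := 0.139060) (a' := 0.139061)
      (b := 0.482577) (b' := 0.482578)
      (d := 0.233791) hα1 hk0 hk hc hck (by norm_num) (by norm_num) (by norm_num) (by norm_num)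
      ⟨binEntropy_one_div_thirtytwo.1.le, binEntropy_one_div_thirtytwo.2.le⟩
      ⟨binEntropy_three_div_sixteen.1.le, binEntropy_three_div_sixteen.2.le⟩
      (by norm_num; linarith [binEntropy_one_div_sixteen.1])
      (by norm_num) m1 m2 m3 (by norm_num) (by norm_num)
  · exact cornerBound_nonneg_of_enclosures (a := 0.233791) (a' := 0.233793)
      (b := 0.311128) (b' := 0.311130)
      (d := 0.376769) hα1 hk0 hk hc hck (by norm_num) (by norm_num) (by norm_num) (by norm_num)
      ⟨binEntropy_one_div_sixteen.1.le, binEntropy_one_div_sixteen.2.le⟩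
      ⟨binEntropy_three_div_thirtytwo.1.le, binEntropy_three_div_thirtytwo.2.le⟩
      (by norm_num; linarith [binEntropy_one_div_eight.1])
      (by norm_num) m1 m2 m3 (by norm_num) (by norm_num)
  · exact cornerBound_nonneg_of_enclosures (a := 0.233791) (a' := 0.233793)
      (b := 0.482577) (b' := 0.482578)
      (d := 0.376769) hα1 hk0 hk hc hck (by norm_num) (by norm_num) (by norm_num) (by norm_num)
      ⟨binEntropy_one_div_sixteen.1.le, binEntropy_one_div_sixteen.2.le⟩
      ⟨binEntropy_three_div_sixteen.1.le, binEntropy_three_div_sixteen.2.le⟩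
      (by norm_num; linarith [binEntropy_one_div_eight.1])
      (by norm_num) m1 m2 m3 (by norm_num) (by norm_num)

theorem kernel_rectangle_wide_top {α k c p q : ℝ}
    (hα1 : α ≤ 0.035609) (hk0 : 0 ≤ k) (hk : k ≤ 0.80951416)
    (hc : 0.057645 ≤ c) (hck : c * k ≤ 0.046672)
    (hp0 : 0 ≤ p) (hp1 : p ≤ 1/16) (hq0 : 3/16 ≤ q) (hq1 : q ≤ 1/2) :
    0 ≤ cornerBound α k c (log (9 / 61)) (log (50 / 61)) (log (2 / 61)) p q := by
  have h2 := log_two_enclosure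
  have h3 := log_three_enclosure
  have h5 := log_five_enclosure
  have h61 := log_sixtyone_enclosure
  have m1 : (-1.913650 : ℝ) ≤ log (9 / 61) := by
    rw [log_div (by norm_num) (by norm_num), show (9 : ℝ) = 3 ^ 2 by norm_num,
      log_pow]
    norm_num
    linarith [h3.1, h3.2, h61.1, h61.2]
  have m2 : (-0.198852 : ℝ) ≤ log (50 / 61) := by
    rw [log_div (by norm_num) (by norm_num), show (50 : ℝ) = 2 * 5 ^ 2 by norm_num,
      log_mul (by norm_num) (by norm_num),
      log_pow]
    norm_num
    linarith [h2.1, h2.2, h5.1, h5.2, h61.1, h61.2]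
  have m3 : (-3.417728 : ℝ) ≤ log (2 / 61) := by
    rw [log_div (by norm_num) (by norm_num)]
    norm_num
    linarith [h2.1, h2.2, h61.1, h61.2]
  refine cornerBound_nonneg_of_corners (p₀ := 0) (p₁ := 1/16) (q₀ := 3/16) (q₁ := 1/2)
    (by linarith) hk0 (by linarith) (by norm_num) (by norm_num) (by norm_num) (by norm_num)
    ?_ ?_ ?_ ?_ hp0 hp1 hq0 hq1
  · exact cornerBound_nonneg_of_enclosures (a := 0) (a' := 0) (b := 0.482577) (b' := 0.482578)
      (d := 0) hα1 hk0 hk hc hck (by norm_num) (by norm_num) (by norm_num) (by norm_num)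
      ⟨by simp, by simp⟩ ⟨binEntropy_three_div_sixteen.1.le, binEntropy_three_div_sixteen.2.le⟩
      (by simp) (by norm_num) m1 m2 m3 (by norm_num) (by norm_num)
  · exact cornerBound_nonneg_of_enclosures (a := 0) (a' := 0) (b := 0.69314718) (b' := 0.69314719)
      (d := 0) hα1 hk0 hk hc hck (by norm_num) (by norm_num) (by norm_num) (by norm_num)
      ⟨by simp, by simp⟩ binEntropy_half_enclosure
      (by simp) (by norm_num) m1 m2 m3 (by norm_num) (by norm_num)
  · exact cornerBound_nonneg_of_enclosures (a := 0.233791) (a' := 0.233793)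
      (b := 0.482577) (b' := 0.482578)
      (d := 0.376769) hα1 hk0 hk hc hck (by norm_num) (by norm_num) (by norm_num) (by norm_num)
      ⟨binEntropy_one_div_sixteen.1.le, binEntropy_one_div_sixteen.2.le⟩
      ⟨binEntropy_three_div_sixteen.1.le, binEntropy_three_div_sixteen.2.le⟩
      (by norm_num; linarith [binEntropy_one_div_eight.1])
      (by norm_num) m1 m2 m3 (by norm_num) (by norm_num)
  · exact cornerBound_nonneg_of_enclosures (a := 0.233791) (a' := 0.233793)
      (b := 0.69314718) (b' := 0.69314719)
      (d := 0.376769) hα1 hk0 hk hc hck (by norm_num) (by norm_num) (by norm_num) (by norm_num)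
      ⟨binEntropy_one_div_sixteen.1.le, binEntropy_one_div_sixteen.2.le⟩ binEntropy_half_enclosure
      (by norm_num; linarith [binEntropy_one_div_eight.1])
      (by norm_num) m1 m2 m3 (by norm_num) (by norm_num)

/-! ### The kernel inequality -/

/-- The dual potential of the coupling problem (shifted by `log 2 / 2`), as a function of
`x = 1 - p`. -/
noncomputable def dualPotential (x : ℝ) : ℝ :=
  if x ≤ 1 / 2 then binEntropy x
  else if x ≤ 3 / 4 then log 2 else (log 2 + binEntropy (2 * x - 1)) / 2

theorem dualPotential_zero : dualPotential 0 = 0 := by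
  simp [dualPotential]

theorem dualPotential_le {x : ℝ} : dualPotential x ≤ log 2 := by
  unfold dualPotential
  split_ifs with a b
  · exact binEntropy_le_log_two
  · exact le_rfl
  · have := binEntropy_le_log_two (p := 2 * x - 1)
    linarith

/-- The truncation of the identity to `[0, 15 / 16]`. -/
noncomputable def truncatedId (x : ℝ) : ℝ := if x ≤ 15 / 16 then x else 0

theorem truncatedId_nonneg {x : ℝ} (h : 0 ≤ x) : 0 ≤ truncatedId x := by
  unfold truncatedId
  split_ifs <;> linarith

theorem truncatedId_le {x : ℝ} (h : 0 ≤ x) : truncatedId x ≤ x := by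
  unfold truncatedId
  split_ifs
  exacts [le_rfl, h]

theorem mul_binEntropy_le_binEntropy_mul {x y : ℝ} (hx0 : 0 ≤ x) (hx1 : x ≤ 1) (hy0 : 0 ≤ y)
    (hy1 : y ≤ 1) : x * binEntropy y ≤ binEntropy (x * y) := by
  simpa using binEntropy_ge_chord (u := 0) le_rfl hy0 zero_le_one hy1 hx0 hx1

namespace CriticalParameters

variable {β k α : ℝ}

theorem diagonal_nonneg (h : CriticalParameters β k α) {x : ℝ} (hx0 : 0 < x)
    (hx1 : x ≤ 15 / 16) :
    0 ≤ entropyDiagonal (1 - α) (2 * k) x +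
      2 * (2 * α * k) * (x * (dualPotential x - log 2 * k * x)) := by
  unfold dualPotential
  split_ifs with a b
  · exact h.diagonal_nonneg_of_le_half hx0 a
  · exact h.diagonal_nonneg_of_mem_middle (not_le.1 a).le b
  · exact h.diagonal_nonneg_of_mem_upper (not_le.1 b).le hx1

/-- For y ≤ 1/2 the chords h(xy) ≥ x h(y) and h(y) ≥ 2y log 2 make everything a multiple of y. For
larger y, a reference law bounds h(xy) below by a function concave in each of 1 - x and 1 - y. -/
theorem mixed_nonneg (h : CriticalParameters β k α) {x y : ℝ} (hx0 : 15 / 16 ≤ x) (hx1 : x ≤ 1)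
    (hy0 : 0 ≤ y) (hy1 : y ≤ 15 / 16) :
    0 ≤ (1 - α) * binEntropy (x * y) - k * (x * binEntropy y + y * binEntropy x) +
      2 * α * k * (y * (dualPotential x - log 2 * k * x)) := by
  have hv : dualPotential x = (log 2 + binEntropy (2 * x - 1)) / 2 := by
    rw [dualPotential, if_neg (by linarith), if_neg (by linarith)]
  rw [hv]
  obtain ⟨c0, c1⟩ := h.weight_bounds
  obtain ⟨e0, e1⟩ := h.weight_mul_slope_bounds
  obtain ⟨L0, L1⟩ := log_two_enclosure
  have hα0 := h.alpha_gt
  have hα1 := h.alpha_lt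
  have hk0 := h.k_gt
  have hk1 := h.k_lt
  set c := 2 * α * k with hc
  rcases le_total y (1 / 2) with hy | hy
  · have t1 := mul_le_mul_of_nonneg_left (mul_binEntropy_le_binEntropy_mul (x := x) (y := y)
      (by linarith) hx1 hy0 (by linarith)) (show 0 ≤ 1 - α by linarith)
    have t2 : 2 * y * log 2 ≤ binEntropy y := by
      have := mul_binEntropy_le_binEntropy_mul (x := 2 * y) (y := 2⁻¹) (by linarith) (by linarith)
        (by norm_num) (by norm_num)
      rwa [binEntropy_two_inv, show 2 * y * 2⁻¹ = y by ring] at this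
    have t3 : binEntropy x ≤ 0.233793 := by
      refine le_trans ?_ binEntropy_fifteen_sixteenths.2.le
      exact binEntropy_strictAntiOn.antitoneOn ⟨by norm_num, by norm_num⟩
        ⟨by linarith, by linarith⟩ hx0
    have t4 := binEntropy_nonneg (p := 2 * x - 1) (by linarith) (by linarith)
    have t5 : 0 ≤ (1 - α - k) * x := mul_nonneg (by linarith) (by linarith)
    have t6 := mul_le_mul_of_nonneg_left t2 t5
    have t7 : k * binEntropy x ≤ 0.80951416 * 0.233793 :=
      mul_le_mul hk1.le t3 (binEntropy_nonneg (by linarith) hx1) (by norm_num)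
    have t8 : 0.154876 * (2 * 0.69314718) * x ≤ (1 - α - k) * (2 * log 2) * x :=
      mul_le_mul_of_nonneg_right (mul_le_mul (by linarith) (by linarith) (by norm_num)
        (by linarith)) (by linarith)
    have t9 : c * k * log 2 * x ≤ 0.046672 * 0.69314719 * x :=
      mul_le_mul_of_nonneg_right (mul_le_mul e1.le (by linarith) (by linarith) (by norm_num))
        (by linarith)
    have t10 : 0.057645 * 0.69314718 / 2 ≤ c * ((log 2 + binEntropy (2 * x - 1)) / 2) := by
      have : (0.057645 : ℝ) * 0.69314718 ≤ c * (log 2 + binEntropy (2 * x - 1)) :=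
        mul_le_mul c0.le (by linarith) (by norm_num) (by linarith)
      linarith
    have t11 : 0 ≤ (1 - α - k) * (2 * log 2) * x - k * binEntropy x +
        c * ((log 2 + binEntropy (2 * x - 1)) / 2) - c * k * log 2 * x := by linarith
    have t12 := mul_nonneg hy0 t11
    linarith
  · have key : ∀ r₁ r₂ r₃ : ℝ, 0 < r₁ → 0 < r₂ → 0 < r₃ → r₁ + r₂ + r₃ ≤ 1 →
        0 ≤ cornerBound α k c (log r₁) (log r₂) (log r₃) (1 - x) (1 - y) →
        0 ≤ (1 - α) * binEntropy (x * y) - k * (x * binEntropy y + y * binEntropy x) +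
          c * (y * ((log 2 + binEntropy (2 * x - 1)) / 2 - log 2 * k * x)) := by
      intro r₁ r₂ r₃ h1 h2 h3 hr hcb
      have ho := binEntropy_or_ge (p := 1 - x) (q := 1 - y) (by linarith) (by linarith)
        (by linarith) (by linarith) h1 h2 h3 hr
      have e1 : binEntropy (1 - x + (1 - y) - (1 - x) * (1 - y)) = binEntropy (x * y) := by
        rw [← binEntropy_one_sub (x * y)]; congr 1; ring
      have e2 : binEntropy (2 * (1 - x)) = binEntropy (2 * x - 1) := by
        rw [← binEntropy_one_sub (2 * x - 1)]; congr 1; ring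
      rw [e1] at ho
      have t1 := mul_le_mul_of_nonneg_left ho (show 0 ≤ 1 - α by linarith)
      unfold cornerBound at hcb
      rw [e2] at hcb
      simp only [binEntropy_one_sub, sub_sub_cancel] at hcb t1
      linarith
    rcases le_total (1 - y) (3 / 16) with hq | hq
    · rcases le_total (1 - x) (1 / 32) with hp | hp
      · exact key _ _ _ (by norm_num) (by norm_num) (by norm_num) (by norm_num)
          (kernel_rectangle_narrow_bottom hα1.le (by linarith) hk1.le c0.le e1.le (by linarith) hp
            (by linarith) hq)
      · rcases le_total (1 - y) (3 / 32) with hq' | hq'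
        · rcases le_total (1 - x) (3 / 64) with hp' | hp'
          · exact key _ _ _ (by norm_num) (by norm_num) (by norm_num) (by norm_num)
              (kernel_rectangle_narrow_middle hα1.le (by linarith) hk1.le c0.le e1.le hp hp'
                (by linarith) hq')
          · exact key _ _ _ (by norm_num) (by norm_num) (by norm_num) (by norm_num)
              (kernel_rectangle_narrow_top hα1.le (by linarith) hk1.le c0.le e1.le hp'
                (by linarith) (by linarith) hq')
        · exact key _ _ _ (by norm_num) (by norm_num) (by norm_num) (by norm_num)
            (kernel_rectangle_wide_middle hα1.le (by linarith) hk1.le c0.le e1.le hp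
              (by linarith) hq' hq)
    · exact key _ _ _ (by norm_num) (by norm_num) (by norm_num) (by norm_num)
        (kernel_rectangle_wide_top hα1.le (by linarith) hk1.le c0.le e1.le (by linarith)
          (by linarith) hq (by linarith))

/-- On one side of 15/16, log-concavity bounds 2xy times the kernel below by y² times the diagonal
at x plus x² times the diagonal at y. Log-concavity is stated for arguments below 1, so x = 1 and y
= 1 are treated directly. -/
theorem kernel_nonneg (h : CriticalParameters β k α) {x y : ℝ} (hx0 : 0 ≤ x) (hx1 : x ≤ 1)
    (hy0 : 0 ≤ y) (hy1 : y ≤ 1) :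
    0 ≤ (1 - α) * binEntropy (x * y) - k * (x * binEntropy y + y * binEntropy x) +
      2 * α * k * (truncatedId x * (dualPotential y - log 2 * k * y) +
        truncatedId y * (dualPotential x - log 2 * k * x)) := by
  have hα0 := h.alpha_gt
  have hα1 := h.alpha_lt
  have hk0 := h.k_gt
  have hk1 := h.k_lt
  rcases hx0.eq_or_lt with rfl | hx0
  · simp [truncatedId, dualPotential_zero]
  rcases hy0.eq_or_lt with rfl | hy0
  · simp [truncatedId, dualPotential_zero]
  have hxy : 0 < 2 * (x * y) := by positivity
  rcases le_or_gt x (15 / 16) with hx | hx <;> rcases le_or_gt y (15 / 16) with hy | hy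
  · simp only [truncatedId, if_pos hx, if_pos hy]
    have d1 := mul_nonneg (sq_nonneg y) (h.diagonal_nonneg hx0 hx)
    have d2 := mul_nonneg (sq_nonneg x) (h.diagonal_nonneg hy0 hy)
    have d3 := mul_le_mul_of_nonneg_left (log_concavity_binEntropy hx0 (by linarith) hy0
      (by linarith)) (show 0 ≤ 1 - α by linarith)
    unfold entropyDiagonal at d1 d2
    refine nonneg_of_mul_nonneg_right (a := 2 * (x * y)) ?_ hxy
    linarith
  · have := h.mixed_nonneg hy.le hy1 hx0.le hx
    simp only [truncatedId, if_pos hx, if_neg (not_le.2 hy), zero_mul, add_zero]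
    rw [mul_comm y x] at this
    linarith
  · have := h.mixed_nonneg hx.le hx1 hy0.le hy
    simp only [truncatedId, if_pos hy, if_neg (not_le.2 hx), zero_mul, zero_add]
    linarith
  · simp only [truncatedId, if_neg (not_le.2 hx), if_neg (not_le.2 hy), zero_mul, add_zero,
      mul_zero]
    rcases hx1.eq_or_lt with rfl | hx1
    · have := mul_nonneg (show 0 ≤ 1 - α - k by linarith) (binEntropy_nonneg hy0.le hy1)
      simp only [one_mul, binEntropy_one, mul_zero, add_zero]
      linarith
    rcases hy1.eq_or_lt with rfl | hy1
    · have := mul_nonneg (show 0 ≤ 1 - α - k by linarith) (binEntropy_nonneg hx0.le hx1.le)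
      simp only [one_mul, mul_one, binEntropy_one, mul_zero, zero_add]
      linarith
    have d1 := mul_nonneg (sq_nonneg y) (h.entropyDiagonal_nonneg_of_ge hx.le hx1.le)
    have d2 := mul_nonneg (sq_nonneg x) (h.entropyDiagonal_nonneg_of_ge hy.le hy1.le)
    have d3 := mul_le_mul_of_nonneg_left (log_concavity_binEntropy hx0 hx1 hy0 hy1)
      (show 0 ≤ 1 - α by linarith)
    unfold entropyDiagonal at d1 d2
    refine nonneg_of_mul_nonneg_right (a := 2 * (x * y)) ?_ hxy
    linarith

end CriticalParameters

/-! ### The inequality for laws on the unit interval -/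

/-- The most entropic admissible probability of a disjunction of bits with biases `p` and `q`. -/
noncomputable def maxEntropyRule (p q : ℝ) : ℝ := max (max p q) (min (1 / 2) (p + q))

theorem dualPotential_one_sub_of_ge {p : ℝ} (h : 1 / 2 ≤ p) :
    dualPotential (1 - p) = binEntropy p := by
  rw [dualPotential, if_pos (by linarith), binEntropy_one_sub]

theorem dualPotential_one_sub_of_le {p : ℝ} (h : p ≤ 1 / 4) :
    dualPotential (1 - p) = (log 2 + binEntropy (2 * p)) / 2 := by
  rw [dualPotential, if_neg (by linarith)]
  split_ifs with h'
  · have : p = 1 / 4 := by linarith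
    rw [this, show (2 : ℝ) * (1 / 4) = 2⁻¹ by norm_num, binEntropy_two_inv]
    ring
  · rw [← binEntropy_one_sub (2 * p)]
    congr 3
    ring

theorem binEntropy_midpoint {p q : ℝ} (hp0 : 0 ≤ p) (hp1 : p ≤ 1) (hq0 : 0 ≤ q) (hq1 : q ≤ 1) :
    (binEntropy p + binEntropy q) / 2 ≤ binEntropy ((p + q) / 2) := by
  have := binEntropy_ge_chord hp0 hq0 hp1 hq1 (s := 1 / 2) (by norm_num) (by norm_num)
  rw [show (1 - 1 / 2) * p + 1 / 2 * q = (p + q) / 2 by ring] at this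
  linarith

/-- Dual feasibility. If q ≥ 1/2 the rule returns q; if q ≤ 1/2 ≤ p + q it reaches the fair bit;
otherwise it returns p + q, the midpoint of 2p and 2q, and concavity of h applies (with 2q lowered
to 1/2 when q ≥ 1/4). -/
theorem dualPotential_add_le_of_le {p q : ℝ} (hp0 : 0 ≤ p) (hpq : p ≤ q) :
    dualPotential (1 - p) + dualPotential (1 - q) - log 2 ≤ binEntropy (maxEntropyRule p q) := by
  have a := dualPotential_le (x := 1 - p)
  have b := dualPotential_le (x := 1 - q)
  have hm : maxEntropyRule p q = max q (min (1 / 2) (p + q)) := by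
    rw [maxEntropyRule, max_eq_right hpq]
  rw [hm]
  rcases le_total (1 / 2) q with hq | hq
  · rw [max_eq_left (min_le_of_left_le hq), dualPotential_one_sub_of_ge hq]
    linarith
  rcases le_total (1 / 2) (p + q) with hs | hs
  · rw [min_eq_left hs, max_eq_right hq, one_div, binEntropy_two_inv]
    linarith
  rw [min_eq_right hs, max_eq_right (by linarith), dualPotential_one_sub_of_le (by linarith)]
  rcases le_total q (1 / 4) with hq4 | hq4
  · rw [dualPotential_one_sub_of_le hq4]
    have := binEntropy_midpoint (p := 2 * p) (q := 2 * q) (by linarith) (by linarith)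
      (by linarith) (by linarith)
    rw [show (2 * p + 2 * q) / 2 = p + q by ring] at this
    linarith
  · have h1 := binEntropy_midpoint (p := 2 * p) (q := 2⁻¹) (by linarith) (by linarith)
      (by norm_num) (by norm_num)
    rw [binEntropy_two_inv] at h1
    have h2 : binEntropy ((2 * p + 2⁻¹) / 2) ≤ binEntropy (p + q) :=
      binEntropy_strictMonoOn.monotoneOn ⟨by linarith, by linarith⟩ ⟨by linarith, by linarith⟩
        (by linarith)
    linarith

theorem maxEntropyRule_comm (p q : ℝ) : maxEntropyRule p q = maxEntropyRule q p := by
  rw [maxEntropyRule, maxEntropyRule, max_comm p, add_comm p]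

theorem dualPotential_add_le {p q : ℝ} (hp0 : 0 ≤ p) (hq0 : 0 ≤ q) :
    dualPotential (1 - p) + dualPotential (1 - q) - log 2 ≤ binEntropy (maxEntropyRule p q) := by
  rcases le_total p q with h | h
  · exact dualPotential_add_le_of_le hp0 h
  · rw [maxEntropyRule_comm, add_comm]
    exact dualPotential_add_le_of_le hq0 h

theorem sum_mul_mul_mul_eq {ι : Type*} [Fintype ι] (w f g : ι → ℝ) :
    ∑ i, ∑ j, w i * w j * (f i * g j) = (∑ i, w i * f i) * ∑ j, w j * g j := by
  rw [Finset.sum_mul_sum]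
  exact Finset.sum_congr rfl fun i _ => Finset.sum_congr rfl fun j _ => by ring

/-- Let `x` have law `w` on `[0, 1]` with mean larger than `1 / (2 k)`, and let `γ` be a coupling
of `w` with itself.  Mixing the independent and the coupled disjunction increases entropy. -/
theorem CriticalParameters.entropy_gain {β k α : ℝ} (h : CriticalParameters β k α) {ι : Type*}
    [Fintype ι] {w x : ι → ℝ} {γ g : ι → ι → ℝ} (hw : ∀ i, 0 ≤ w i) (hw1 : ∑ i, w i = 1)
    (hx0 : ∀ i, 0 ≤ x i) (hx1 : ∀ i, x i ≤ 1) (hmean : 1 < 2 * k * ∑ i, w i * x i)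
    (hγ : ∀ i j, 0 ≤ γ i j) (hγ₁ : ∀ i, ∑ j, γ i j = w i) (hγ₂ : ∀ j, ∑ i, γ i j = w j)
    (hg : ∀ i j, 0 ≤ g i j)
    (hdual : ∀ i j, dualPotential (x i) + dualPotential (x j) - log 2 ≤ g i j) :
    ∑ i, w i * binEntropy (x i) ≤ (1 - α) * (∑ i, ∑ j, w i * w j * binEntropy (x i * x j)) +
      α * ∑ i, ∑ j, γ i j * g i j ∧
    (0 < ∑ i, w i * binEntropy (x i) →
      ∑ i, w i * binEntropy (x i) < (1 - α) * (∑ i, ∑ j, w i * w j * binEntropy (x i * x j)) +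
        α * ∑ i, ∑ j, γ i j * g i j) := by
  have hα0 := h.alpha_gt
  have hα1 := h.alpha_lt
  have hk0 := h.k_gt
  have hL : 0 < log 2 := log_pos one_lt_two
  set X := ∑ i, w i * x i with hX
  set E := ∑ i, w i * binEntropy (x i) with hE
  set K := ∑ i, ∑ j, w i * w j * binEntropy (x i * x j) with hK
  set P := ∑ i, ∑ j, γ i j * g i j with hP
  set R := ∑ i, w i * truncatedId (x i) with hR
  set V := ∑ i, w i * dualPotential (x i) with hV
  -- The kernel inequality integrated against the product of w with itself.
  have hker : 0 ≤ (1 - α) * K - 2 * k * (X * E) + 2 * (2 * α * k) * (R * (V - log 2 * k * X)) := by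
    have h1 : 0 ≤ ∑ i, ∑ j, w i * w j * ((1 - α) * binEntropy (x i * x j) -
        k * (x i * binEntropy (x j) + x j * binEntropy (x i)) +
        2 * α * k * (truncatedId (x i) * (dualPotential (x j) - log 2 * k * x j) +
          truncatedId (x j) * (dualPotential (x i) - log 2 * k * x i))) :=
      Finset.sum_nonneg fun i _ => Finset.sum_nonneg fun j _ =>
        mul_nonneg (mul_nonneg (hw i) (hw j))
          (h.kernel_nonneg (hx0 i) (hx1 i) (hx0 j) (hx1 j))
    have h2 : ∑ i, ∑ j, w i * w j * ((1 - α) * binEntropy (x i * x j) -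
        k * (x i * binEntropy (x j) + x j * binEntropy (x i)) +
        2 * α * k * (truncatedId (x i) * (dualPotential (x j) - log 2 * k * x j) +
          truncatedId (x j) * (dualPotential (x i) - log 2 * k * x i))) =
        (1 - α) * K
        - k * (∑ i, ∑ j, w i * w j * (x i * binEntropy (x j)))
        - k * (∑ i, ∑ j, w i * w j * (binEntropy (x i) * x j))
        + 2 * α * k * (∑ i, ∑ j, w i * w j * (truncatedId (x i) * dualPotential (x j)))
        - 2 * α * k * (log 2 * k) * (∑ i, ∑ j, w i * w j * (truncatedId (x i) * x j))
        + 2 * α * k * (∑ i, ∑ j, w i * w j * (dualPotential (x i) * truncatedId (x j)))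
        - 2 * α * k * (log 2 * k) * (∑ i, ∑ j, w i * w j * (x i * truncatedId (x j))) := by
      rw [hK]
      simp only [Finset.mul_sum, ← Finset.sum_add_distrib, ← Finset.sum_sub_distrib]
      exact Finset.sum_congr rfl fun i _ => Finset.sum_congr rfl fun j _ => by ring
    rw [h2] at h1
    simp only [sum_mul_mul_mul_eq] at h1
    linarith
  have hP0 : 0 ≤ P := Finset.sum_nonneg fun i _ => Finset.sum_nonneg fun j _ =>
    mul_nonneg (hγ i j) (hg i j)
  -- Weak duality: only the marginals of γ enter.
  have hPV : 2 * V - log 2 ≤ P := by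
    have h1 : ∑ i, ∑ j, γ i j * (dualPotential (x i) + dualPotential (x j) - log 2) ≤ P :=
      Finset.sum_le_sum fun i _ => Finset.sum_le_sum fun j _ =>
        mul_le_mul_of_nonneg_left (hdual i j) (hγ i j)
    have h2 : ∑ i, ∑ j, γ i j * dualPotential (x i) = V :=
      Finset.sum_congr rfl fun i _ => by rw [← Finset.sum_mul, hγ₁]
    have h3 : ∑ i, ∑ j, γ i j * dualPotential (x j) = V := by
      rw [Finset.sum_comm]
      exact Finset.sum_congr rfl fun i _ => by rw [← Finset.sum_mul, hγ₂]
    have h4 : ∑ i, ∑ j, γ i j * log 2 = log 2 := by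
      simp only [← Finset.sum_mul, hγ₁, hw1, one_mul]
    simp only [mul_sub, mul_add, Finset.sum_add_distrib, Finset.sum_sub_distrib, h2, h3, h4] at h1
    linarith
  have hR0 : 0 ≤ R := Finset.sum_nonneg fun i _ => mul_nonneg (hw i) (truncatedId_nonneg (hx0 i))
  have hRX : R ≤ X := Finset.sum_le_sum fun i _ =>
    mul_le_mul_of_nonneg_left (truncatedId_le (hx0 i)) (hw i)
  have hE0 : 0 ≤ E := Finset.sum_nonneg fun i _ =>
    mul_nonneg (hw i) (binEntropy_nonneg (hx0 i) (hx1 i))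
  have hKX : X * E ≤ K := by
    rw [hX, hE, ← sum_mul_mul_mul_eq]
    exact Finset.sum_le_sum fun i _ => Finset.sum_le_sum fun j _ =>
      mul_le_mul_of_nonneg_left (mul_binEntropy_le_binEntropy_mul (hx0 i) (hx1 i) (hx0 j) (hx1 j))
        (mul_nonneg (hw i) (hw j))
  have hX0 : 0 < X := by
    by_contra! hn
    nlinarith
  have hs : 0 < 2 * k * X := by linarith
  have hbound : R * (V - log 2 * k * X) ≤ X * (P / 2) := by
    -- The mean condition 2kX > 1 turns log 2 · k X into at least log 2 / 2.
    have h1 : V - log 2 * k * X ≤ P / 2 := by nlinarith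
    calc R * (V - log 2 * k * X) ≤ R * (P / 2) := mul_le_mul_of_nonneg_left h1 hR0
      _ ≤ X * (P / 2) := mul_le_mul_of_nonneg_right hRX (by linarith)
  have hmain : 2 * k * X * E ≤ (1 - α) * K + 2 * k * X * (α * P) := by
    have : 2 * (2 * α * k) * (R * (V - log 2 * k * X)) ≤ 2 * (2 * α * k) * (X * (P / 2)) :=
      mul_le_mul_of_nonneg_left hbound (by
        have : 0 ≤ α * k := mul_nonneg (by linarith) (by linarith)
        linarith)
    linarith
  have hK0 : 0 ≤ K := le_trans (mul_nonneg hX0.le hE0) hKX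
  have hα : 0 < 1 - α := by linarith
  constructor
  · have h1 : 2 * k * X * E ≤ 2 * k * X * ((1 - α) * K + α * P) := by
      nlinarith [mul_nonneg (mul_nonneg hα.le hK0) (sub_nonneg.2 hmean.le)]
    exact le_of_mul_le_mul_left h1 hs
  · intro hpos
    have hKpos : 0 < K := lt_of_lt_of_le (mul_pos hX0 hpos) hKX
    have h1 : 2 * k * X * E < 2 * k * X * ((1 - α) * K + α * P) := by
      -- Strictness comes from the slack (2kX - 1)(1 - α)K.
      nlinarith [mul_pos (mul_pos hα hKpos) (sub_pos.2 hmean)]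
    exact lt_of_mul_lt_mul_left h1 hs.le

/-! ### Revealing a set one element at a time -/

/-- Binary words of length `k`, extended on the right. -/
def BitPrefix : ℕ → Type
  | 0 => Unit
  | k + 1 => BitPrefix k × Bool

noncomputable instance BitPrefix.instFintype : (k : ℕ) → Fintype (BitPrefix k)
  | 0 => inferInstanceAs (Fintype Unit)
  | k + 1 =>
    have := BitPrefix.instFintype k
    inferInstanceAs (Fintype (BitPrefix k × Bool))

instance BitPrefix.instDecidableEq : (k : ℕ) → DecidableEq (BitPrefix k)
  | 0 => inferInstanceAs (DecidableEq Unit)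
  | k + 1 =>
    have := BitPrefix.instDecidableEq k
    inferInstanceAs (DecidableEq (BitPrefix k × Bool))

namespace BitPrefix

/-- Extend a word by a bit. -/
def snoc {k : ℕ} (s : BitPrefix k) (a : Bool) : BitPrefix (k + 1) := (s, a)

/-- The empty word. -/
def nil : BitPrefix 0 := ()

theorem sum_zero (f : BitPrefix 0 → ℝ) : ∑ s, f s = f nil :=
  Fintype.sum_unique (ι := Unit) f

theorem sum_succ {k : ℕ} (f : BitPrefix (k + 1) → ℝ) :
    ∑ s, f s = ∑ s : BitPrefix k, (f (s.snoc true) + f (s.snoc false)) := by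
  have := Fintype.sum_prod_type (α₁ := BitPrefix k) (α₂ := Bool) f
  rw [show ∑ s, f s = ∑ s : BitPrefix k × Bool, f s from rfl, this]
  exact Finset.sum_congr rfl fun s _ => Fintype.sum_bool _

theorem snoc_inj {k : ℕ} {s t : BitPrefix k} {a b : Bool} :
    s.snoc a = t.snoc b ↔ s = t ∧ a = b :=
  Prod.mk_inj

/-- Bitwise disjunction of words. -/
def join : {k : ℕ} → BitPrefix k → BitPrefix k → BitPrefix k
  | 0, _, _ => ()
  | _ + 1, s, t => (join s.1 t.1, s.2 || t.2)

theorem join_snoc {k : ℕ} (s t : BitPrefix k) (a b : Bool) :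
    join (s.snoc a) (t.snoc b) = (join s t).snoc (a || b) := rfl

end BitPrefix

/-! ### Prefix statistics of a uniform member -/

section UniformMember

variable {n : ℕ}

/-- Whether `k` belongs to `A`. -/
def memBit (A : Finset (Fin n)) (k : ℕ) : Bool := decide (∃ h : k < n, (⟨k, h⟩ : Fin n) ∈ A)

/-- The indicator word of the first `k` elements. -/
def encode (A : Finset (Fin n)) : (k : ℕ) → BitPrefix k
  | 0 => ()
  | k + 1 => (encode A k).snoc (memBit A k)

theorem memBit_union (A B : Finset (Fin n)) (k : ℕ) :
    memBit (A ∪ B) k = (memBit A k || memBit B k) := by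
  simp only [memBit, Finset.mem_union, exists_or, Bool.decide_or]

theorem encode_union (A B : Finset (Fin n)) (k : ℕ) :
    encode (A ∪ B) k = BitPrefix.join (encode A k) (encode B k) := by
  induction k with
  | zero => rfl
  | succ k ih =>
    change (encode (A ∪ B) k).snoc (memBit (A ∪ B) k) = _
    rw [ih, memBit_union]
    rfl

theorem memBit_eq_of_encode_eq {A B : Finset (Fin n)} {k : ℕ} (h : encode A k = encode B k)
    {j : ℕ} (hj : j < k) : memBit A j = memBit B j := by
  induction k with
  | zero => omega
  | succ k ih =>
    obtain ⟨h1, h2⟩ := BitPrefix.snoc_inj.1 h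
    rcases Nat.lt_succ_iff_lt_or_eq.1 hj with h' | rfl
    · exact ih h1 h'
    · exact h2

theorem encode_injective : Function.Injective fun A : Finset (Fin n) => encode A n := by
  intro A B h
  ext i
  have := memBit_eq_of_encode_eq h i.2
  simpa [memBit] using this

/-- Number of members of the family with a given prefix. -/
def prefixCount (F : Finset (Finset (Fin n))) {k : ℕ} (s : BitPrefix k) : ℕ :=
  (F.filter fun A => encode A k = s).card

/-- Probability of a prefix for a uniformly random member of the family. -/
noncomputable def prefixProb (F : Finset (Finset (Fin n))) {k : ℕ} (s : BitPrefix k) : ℝ :=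
  prefixCount F s / F.card

/-- Conditional probability that the next bit is set. -/
noncomputable def condProb (F : Finset (Finset (Fin n))) {k : ℕ} (s : BitPrefix k) : ℝ :=
  prefixCount F (s.snoc true) / prefixCount F s

variable {F : Finset (Finset (Fin n))}

theorem prefixCount_add {k : ℕ} (s : BitPrefix k) :
    prefixCount F (s.snoc true) + prefixCount F (s.snoc false) = prefixCount F s := by
  unfold prefixCount
  rw [← Finset.card_filter_add_card_filter_not (s := F.filter fun A => encode A k = s)
    (fun A => memBit A k = true), Finset.filter_filter, Finset.filter_filter]
  congr 2
  · ext A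
    simp only [Finset.mem_filter]
    exact and_congr_right fun _ => BitPrefix.snoc_inj
  · ext A
    simp only [Finset.mem_filter, Bool.not_eq_true]
    exact and_congr_right fun _ => BitPrefix.snoc_inj

theorem condProb_nonneg {k : ℕ} (s : BitPrefix k) : 0 ≤ condProb F s := by
  unfold condProb; positivity

theorem condProb_le_one {k : ℕ} (s : BitPrefix k) : condProb F s ≤ 1 := by
  unfold condProb
  apply div_le_one_of_le₀ _ (by positivity)
  exact_mod_cast (prefixCount_add (F := F) s) ▸ Nat.le_add_right _ _

theorem prefixProb_nonneg {k : ℕ} (s : BitPrefix k) : 0 ≤ prefixProb F s := by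
  unfold prefixProb; positivity

theorem prefixProb_snoc_true {k : ℕ} (s : BitPrefix k) :
    prefixProb F (s.snoc true) = prefixProb F s * condProb F s := by
  unfold prefixProb condProb
  rcases Nat.eq_zero_or_pos (prefixCount F s) with h | h
  -- On a prefix of count zero `condProb` is 0/0 = 0, and both sides vanish.
  · have := prefixCount_add (F := F) s
    have h0 : prefixCount F (s.snoc true) = 0 := by omega
    simp [h, h0]
  · have : (prefixCount F s : ℝ) ≠ 0 := by positivity
    field_simp

theorem prefixProb_snoc_false {k : ℕ} (s : BitPrefix k) :
    prefixProb F (s.snoc false) = prefixProb F s * (1 - condProb F s) := by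
  have h : prefixProb F (s.snoc true) + prefixProb F (s.snoc false) = prefixProb F s := by
    unfold prefixProb
    rw [← add_div]
    congr 1
    exact_mod_cast prefixCount_add s
  rw [prefixProb_snoc_true] at h
  linarith

theorem prefixProb_zero (hF : F.Nonempty) (s : BitPrefix 0) : prefixProb F s = 1 := by
  have : prefixCount F s = F.card := by
    unfold prefixCount
    rw [Finset.filter_true_of_mem]
    intro A _
    rfl
  rw [prefixProb, this, div_self]
  exact_mod_cast hF.card_pos.ne'

theorem sum_prefixProb (hF : F.Nonempty) (k : ℕ) : ∑ s : BitPrefix k, prefixProb F s = 1 := by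
  induction k with
  | zero => rw [BitPrefix.sum_zero, prefixProb_zero hF]
  | succ k ih =>
    rw [BitPrefix.sum_succ, ← ih]
    refine Finset.sum_congr rfl fun s _ => ?_
    rw [prefixProb_snoc_true, prefixProb_snoc_false]
    ring

/-- Law of total probability over the prefixes: this is how element frequencies enter the mean
condition. -/
theorem sum_prefixProb_mul_condProb (i : Fin n) :
    ∑ s : BitPrefix i, prefixProb F s * condProb F s =
      ((F.filter fun A => i ∈ A).card : ℝ) / F.card := by
  simp only [← prefixProb_snoc_true]
  unfold prefixProb
  rw [← Finset.sum_div]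
  congr 1
  have := Finset.card_eq_sum_card_fiberwise (s := F.filter fun A => i ∈ A)
    (t := (Finset.univ : Finset (BitPrefix i))) (f := fun A => encode A i) (fun _ _ => by simp)
  rw [this]
  push_cast
  refine Finset.sum_congr rfl fun s _ => ?_
  congr 1
  unfold prefixCount
  congr 1
  ext A
  simp only [Finset.mem_filter, and_assoc]
  refine and_congr_right fun _ => ?_
  have e : encode A (i + 1) = (encode A i).snoc (memBit A i) := rfl
  rw [e, BitPrefix.snoc_inj, and_comm]
  simp [memBit]

/-! ### Entropy along the revelation -/

theorem negMulLog_split (v p : ℝ) :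
    negMulLog (v * p) + negMulLog (v * (1 - p)) = negMulLog v + v * binEntropy p := by
  rw [negMulLog_mul, negMulLog_mul, binEntropy_eq_negMulLog_add_negMulLog_one_sub]
  ring

/-- Splitting a mixture increases the entropy at least by the mean entropy of the splits. -/
theorem negMulLog_add_sum_le {ι : Type*} [Fintype ι] {c r : ι → ℝ} (hc : ∀ i, 0 ≤ c i)
    (hr0 : ∀ i, 0 ≤ r i) (hr1 : ∀ i, r i ≤ 1) :
    negMulLog (∑ i, c i) + ∑ i, c i * binEntropy (r i) ≤
      negMulLog (∑ i, c i * r i) + negMulLog (∑ i, c i * (1 - r i)) := by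
  set v := ∑ i, c i with hv
  have hv0 : 0 ≤ v := Finset.sum_nonneg fun i _ => hc i
  rcases hv0.eq_or_lt with h | h
  · have hz : ∀ i, c i = 0 := fun i =>
      (Finset.sum_eq_zero_iff_of_nonneg fun i _ => hc i).1 (hv ▸ h.symm) i (Finset.mem_univ i)
    simp [hv, hz]
  · set P := (∑ i, c i * r i) / v with hP
    have h1 : ∑ i, c i * r i = v * P := by rw [hP, mul_div_cancel₀ _ h.ne']
    have h2 : ∑ i, c i * (1 - r i) = v * (1 - P) := by
      simp only [mul_sub, mul_one, Finset.sum_sub_distrib, h1, ← hv]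
    rw [h1, h2, negMulLog_split]
    -- Jensen's inequality with the normalized weights c/v.
    have hj := strictConcave_binEntropy.concaveOn.le_map_sum (t := Finset.univ)
      (w := fun i => c i / v) (p := r) (fun i _ => div_nonneg (hc i) h.le)
      (by rw [← Finset.sum_div, ← hv, div_self h.ne']) (fun i _ => ⟨hr0 i, hr1 i⟩)
    simp only [smul_eq_mul] at hj
    have e1 : ∑ i, c i / v * r i = P := by
      rw [hP, Finset.sum_div]
      exact Finset.sum_congr rfl fun i _ => by ring
    have e2 : ∑ i, c i / v * binEntropy (r i) = (∑ i, c i * binEntropy (r i)) / v := by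
      rw [Finset.sum_div]
      exact Finset.sum_congr rfl fun i _ => by ring
    rw [e1, e2, div_le_iff₀ h] at hj
    linarith

/-- Chain rule for entropy, telescoped over the prefix length. -/
theorem sum_prefixProb_entropy (hF : F.Nonempty) (k : ℕ) :
    ∑ j ∈ Finset.range k, ∑ s : BitPrefix j, prefixProb F s * binEntropy (condProb F s) =
      ∑ s : BitPrefix k, negMulLog (prefixProb F s) := by
  induction k with
  | zero => simp [prefixProb_zero hF]
  | succ k ih =>
    rw [Finset.sum_range_succ, ih, BitPrefix.sum_succ, ← Finset.sum_add_distrib]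
    refine Finset.sum_congr rfl fun s _ => ?_
    rw [prefixProb_snoc_true, prefixProb_snoc_false, negMulLog_split]

theorem log_card_le_sum_prefixProb_entropy (hF : F.Nonempty) :
    log F.card ≤
      ∑ j ∈ Finset.range n, ∑ s : BitPrefix j, prefixProb F s * binEntropy (condProb F s) := by
  have hN : (0 : ℝ) < F.card := by exact_mod_cast hF.card_pos
  rw [sum_prefixProb_entropy hF]
  have hle : ∀ s : BitPrefix n, prefixProb F s ≤ 1 := fun s => by
    rw [← sum_prefixProb hF n]
    exact Finset.single_le_sum (fun t _ => prefixProb_nonneg t) (Finset.mem_univ s)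
  calc log F.card = ∑ A ∈ F, negMulLog (prefixProb F (encode A n)) := by
        have h1 : ∀ A ∈ F, negMulLog (prefixProb F (encode A n)) = log F.card / F.card := by
          intro A hA
          have : prefixCount F (encode A n) = 1 := by
            rw [prefixCount, Finset.card_eq_one]
            refine ⟨A, ?_⟩
            ext B
            simp only [Finset.mem_filter, Finset.mem_singleton]
            constructor
            · rintro ⟨-, h⟩
              exact encode_injective h
            · rintro rfl
              exact ⟨hA, rfl⟩
          rw [prefixProb, this, negMulLog]
          simp
          ring
        rw [Finset.sum_congr rfl h1, Finset.sum_const, nsmul_eq_mul]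
        field_simp
    _ = ∑ s ∈ F.image fun A => encode A n, negMulLog (prefixProb F s) := by
        rw [Finset.sum_image fun A _ B _ h => encode_injective h]
    _ ≤ ∑ s : BitPrefix n, negMulLog (prefixProb F s) :=
        Finset.sum_le_sum_of_subset_of_nonneg (Finset.subset_univ _) fun s _ _ =>
          negMulLog_nonneg (prefixProb_nonneg s) (hle s)

/-! ### Stepwise couplings of two random members -/

/-- A rule choosing the probability of the disjunction of two bits with given biases, within the
Fréchet bounds. -/
structure IsDisjunctionRule (r : ℝ → ℝ → ℝ) : Prop where
  left_le : ∀ {p q : ℝ}, 0 ≤ p → p ≤ 1 → 0 ≤ q → q ≤ 1 → p ≤ r p q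
  right_le : ∀ {p q : ℝ}, 0 ≤ p → p ≤ 1 → 0 ≤ q → q ≤ 1 → q ≤ r p q
  le_add : ∀ {p q : ℝ}, 0 ≤ p → p ≤ 1 → 0 ≤ q → q ≤ 1 → r p q ≤ p + q
  le_one : ∀ {p q : ℝ}, 0 ≤ p → p ≤ 1 → 0 ≤ q → q ≤ 1 → r p q ≤ 1

theorem isDisjunctionRule_independent : IsDisjunctionRule fun p q => p + q - p * q where
  left_le := by intro p q _ _ _ _; nlinarith
  right_le := by intro p q _ _ _ _; nlinarith
  le_add := by intro p q _ _ _ _; nlinarith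
  le_one := by intro p q _ _ _ _; nlinarith

theorem isDisjunctionRule_maxEntropy : IsDisjunctionRule maxEntropyRule where
  left_le := fun _ _ _ _ => (le_max_left _ _).trans (le_max_left _ _)
  right_le := fun _ _ _ _ => (le_max_right _ _).trans (le_max_left _ _)
  le_add := fun _ _ _ _ => max_le (max_le (by linarith) (by linarith)) (min_le_right _ _)
  le_one := fun _ _ _ _ => max_le (max_le (by linarith) (by linarith))
    ((min_le_left _ _).trans (by norm_num))

/-- The joint law of two bits with biases `p`, `q` and disjunction probability `r`. -/
def jointBit (r p q : ℝ) : Bool → Bool → ℝ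
  | true, true => p + q - r
  | true, false => r - q
  | false, true => r - p
  | false, false => 1 - r

/-- The law of a pair of prefixes revealed bit by bit according to a disjunction rule. -/
noncomputable def coupling (F : Finset (Finset (Fin n))) (r : ℝ → ℝ → ℝ) :
    {k : ℕ} → BitPrefix k → BitPrefix k → ℝ
  | 0, _, _ => 1
  | _ + 1, s, t => coupling F r s.1 t.1 *
      jointBit (r (condProb F s.1) (condProb F t.1)) (condProb F s.1) (condProb F t.1) s.2 t.2

theorem coupling_snoc (r : ℝ → ℝ → ℝ) {k : ℕ} (s t : BitPrefix k) (a b : Bool) :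
    coupling F r (s.snoc a) (t.snoc b) = coupling F r s t *
      jointBit (r (condProb F s) (condProb F t)) (condProb F s) (condProb F t) a b := rfl

variable {r : ℝ → ℝ → ℝ}

theorem IsDisjunctionRule.mem_unitInterval (hr : IsDisjunctionRule r) {k : ℕ} (s t : BitPrefix k) :
    0 ≤ r (condProb F s) (condProb F t) ∧ r (condProb F s) (condProb F t) ≤ 1 :=
  ⟨(condProb_nonneg s).trans (hr.left_le (condProb_nonneg _) (condProb_le_one _)
      (condProb_nonneg _) (condProb_le_one _)),
    hr.le_one (condProb_nonneg _) (condProb_le_one _) (condProb_nonneg _) (condProb_le_one _)⟩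

theorem coupling_nonneg (hr : IsDisjunctionRule r) {k : ℕ} (s t : BitPrefix k) :
    0 ≤ coupling F r s t := by
  induction k with
  | zero => exact zero_le_one
  | succ k ih =>
    obtain ⟨s, a⟩ := s
    obtain ⟨t, b⟩ := t
    change 0 ≤ coupling F r (s.snoc a) (t.snoc b)
    rw [coupling_snoc]
    refine mul_nonneg (ih s t) ?_
    have hs0 := condProb_nonneg (F := F) s
    have hs1 := condProb_le_one (F := F) s
    have ht0 := condProb_nonneg (F := F) t
    have ht1 := condProb_le_one (F := F) t
    have h1 := hr.left_le hs0 hs1 ht0 ht1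
    have h2 := hr.right_le hs0 hs1 ht0 ht1
    have h3 := hr.le_add hs0 hs1 ht0 ht1
    have h4 := hr.le_one hs0 hs1 ht0 ht1
    cases a <;> cases b <;> simp only [jointBit] <;> linarith

theorem sum_coupling_right (hF : F.Nonempty) {k : ℕ} (s : BitPrefix k) :
    ∑ t, coupling F r s t = prefixProb F s := by
  induction k with
  | zero => rw [BitPrefix.sum_zero, prefixProb_zero hF]; rfl
  | succ k ih =>
    obtain ⟨s, a⟩ := s
    change ∑ t, coupling F r (s.snoc a) t = prefixProb F (s.snoc a)
    rw [BitPrefix.sum_succ]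
    cases a
    · rw [prefixProb_snoc_false, ← ih s, Finset.sum_mul]
      refine Finset.sum_congr rfl fun t _ => ?_
      simp only [coupling_snoc, jointBit]
      ring
    · rw [prefixProb_snoc_true, ← ih s, Finset.sum_mul]
      refine Finset.sum_congr rfl fun t _ => ?_
      simp only [coupling_snoc, jointBit]
      ring

theorem sum_coupling_left (hF : F.Nonempty) {k : ℕ} (t : BitPrefix k) :
    ∑ s, coupling F r s t = prefixProb F t := by
  induction k with
  | zero => rw [BitPrefix.sum_zero, prefixProb_zero hF]; rfl
  | succ k ih =>
    obtain ⟨t, b⟩ := t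
    change ∑ s, coupling F r s (t.snoc b) = prefixProb F (t.snoc b)
    rw [BitPrefix.sum_succ]
    cases b
    · rw [prefixProb_snoc_false, ← ih t, Finset.sum_mul]
      refine Finset.sum_congr rfl fun s _ => ?_
      simp only [coupling_snoc, jointBit]
      ring
    · rw [prefixProb_snoc_true, ← ih t, Finset.sum_mul]
      refine Finset.sum_congr rfl fun s _ => ?_
      simp only [coupling_snoc, jointBit]
      ring

theorem coupling_independent (hF : F.Nonempty) {k : ℕ} (s t : BitPrefix k) :
    coupling F (fun p q => p + q - p * q) s t = prefixProb F s * prefixProb F t := by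
  induction k with
  | zero => rw [prefixProb_zero hF, prefixProb_zero hF, one_mul]; rfl
  | succ k ih =>
    obtain ⟨s, a⟩ := s
    obtain ⟨t, b⟩ := t
    change coupling F _ (s.snoc a) (t.snoc b) = prefixProb F (s.snoc a) * prefixProb F (t.snoc b)
    rw [coupling_snoc, ih]
    cases a <;> cases b <;>
      simp only [jointBit, prefixProb_snoc_true, prefixProb_snoc_false] <;> ring

/-! ### Entropy of the union under a stepwise coupling -/

/-- The law of the disjunction of the two coupled prefixes. -/
noncomputable def joinProb (F : Finset (Finset (Fin n))) (r : ℝ → ℝ → ℝ) {k : ℕ}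
    (u : BitPrefix k) : ℝ :=
  ∑ z : BitPrefix k × BitPrefix k,
    if BitPrefix.join z.1 z.2 = u then coupling F r z.1 z.2 else 0

theorem joinProb_snoc {k : ℕ} (u : BitPrefix k) (e : Bool) :
    joinProb F r (u.snoc e) = ∑ z : BitPrefix k × BitPrefix k,
      (if BitPrefix.join z.1 z.2 = u then coupling F r z.1 z.2 else 0) *
        (if e then r (condProb F z.1) (condProb F z.2)
          else 1 - r (condProb F z.1) (condProb F z.2)) := by
  unfold joinProb
  rw [Fintype.sum_prod_type, Fintype.sum_prod_type, BitPrefix.sum_succ]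
  refine Finset.sum_congr rfl fun s _ => ?_
  rw [BitPrefix.sum_succ, BitPrefix.sum_succ, ← Finset.sum_add_distrib]
  refine Finset.sum_congr rfl fun t _ => ?_
  simp only [BitPrefix.join_snoc, BitPrefix.snoc_inj, coupling_snoc, jointBit]
  by_cases h : BitPrefix.join s t = u
  · cases e
    · simp [h]
    · simp [h]
      ring
  · simp [h]

/-- The next bit of the union has at least as much entropy given the prefix of the union as given
both coupled prefixes, because the latter determine the former. The chain rule sums this over the
steps. -/
theorem sum_entropy_le_entropy_joinProb (hr : IsDisjunctionRule r) (k : ℕ) :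
    ∑ j ∈ Finset.range k, ∑ s : BitPrefix j, ∑ t : BitPrefix j,
      coupling F r s t * binEntropy (r (condProb F s) (condProb F t)) ≤
      ∑ u : BitPrefix k, negMulLog (joinProb F r u) := by
  induction k with
  | zero =>
    have h : joinProb F r BitPrefix.nil = 1 := by
      rw [joinProb, Fintype.sum_prod_type, BitPrefix.sum_zero, BitPrefix.sum_zero]
      exact if_pos rfl
    rw [Finset.sum_range_zero, BitPrefix.sum_zero, h, negMulLog_one]
  | succ k ih =>
    rw [Finset.sum_range_succ, BitPrefix.sum_succ]
    have hstep : ∀ u : BitPrefix k, negMulLog (joinProb F r u) +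
        ∑ z : BitPrefix k × BitPrefix k,
          (if BitPrefix.join z.1 z.2 = u then coupling F r z.1 z.2 else 0) *
            binEntropy (r (condProb F z.1) (condProb F z.2)) ≤
        negMulLog (joinProb F r (u.snoc true)) + negMulLog (joinProb F r (u.snoc false)) := by
      intro u
      rw [joinProb_snoc, joinProb_snoc]
      simp only [if_true, Bool.false_eq_true, if_false]
      refine negMulLog_add_sum_le (fun z => ?_) (fun z => (hr.mem_unitInterval _ _).1)
        (fun z => (hr.mem_unitInterval _ _).2)
      split_ifs
      · exact coupling_nonneg hr _ _
      · exact le_rfl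
    refine le_trans ?_ (Finset.sum_le_sum fun u _ => hstep u)
    rw [Finset.sum_add_distrib]
    refine add_le_add ih (le_of_eq ?_)
    rw [Finset.sum_comm (s := (Finset.univ : Finset (BitPrefix k)))
      (t := (Finset.univ : Finset (BitPrefix k × BitPrefix k))), Fintype.sum_prod_type]
    refine Finset.sum_congr rfl fun s _ => Finset.sum_congr rfl fun t _ => ?_
    rw [← Finset.sum_mul]
    simp

theorem exists_of_prefixProb_ne_zero {k : ℕ} {s : BitPrefix k} (h : prefixProb F s ≠ 0) :
    ∃ A ∈ F, encode A k = s := by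
  have : prefixCount F s ≠ 0 := by
    rintro h0
    exact h (by simp [prefixProb, h0])
  obtain ⟨A, hA⟩ := Finset.card_pos.1 (Nat.pos_of_ne_zero this)
  exact ⟨A, (Finset.mem_filter.1 hA).1, (Finset.mem_filter.1 hA).2⟩

theorem sum_joinProb (hF : F.Nonempty) (k : ℕ) : ∑ u : BitPrefix k, joinProb F r u = 1 := by
  unfold joinProb
  rw [Finset.sum_comm]
  simp only [Finset.sum_ite_eq, Finset.mem_univ, if_true]
  rw [Fintype.sum_prod_type]
  simp only [sum_coupling_right hF, sum_prefixProb hF]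

theorem joinProb_nonneg (hr : IsDisjunctionRule r) {k : ℕ} (u : BitPrefix k) :
    0 ≤ joinProb F r u := by
  refine Finset.sum_nonneg fun z _ => ?_
  split_ifs
  · exact coupling_nonneg hr _ _
  · exact le_rfl

/-- A pair of positive coupled mass has marginals of positive mass, so both prefixes come from
members of F, and their join is a prefix of the union. This is the only place where union-closedness
acts. -/
theorem joinProb_eq_zero (hF : F.Nonempty) (hU : UnionClosed F) (hr : IsDisjunctionRule r) {k : ℕ}
    {u : BitPrefix k} (hu : ∀ A ∈ F, encode A k ≠ u) : joinProb F r u = 0 := by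
  refine Finset.sum_eq_zero fun z _ => ?_
  split_ifs with hz
  · by_contra hne
    have hpos : 0 < coupling F r z.1 z.2 := lt_of_le_of_ne (coupling_nonneg hr _ _) (Ne.symm hne)
    have h1 : prefixProb F z.1 ≠ 0 := by
      rw [← sum_coupling_right (r := r) hF]
      exact (lt_of_lt_of_le hpos (Finset.single_le_sum (f := fun t => coupling F r z.1 t)
        (fun t _ => coupling_nonneg hr _ t) (Finset.mem_univ z.2))).ne'
    have h2 : prefixProb F z.2 ≠ 0 := by
      rw [← sum_coupling_left (r := r) hF]
      exact (lt_of_lt_of_le hpos (Finset.single_le_sum (f := fun s => coupling F r s z.2)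
        (fun s _ => coupling_nonneg hr s _) (Finset.mem_univ z.1))).ne'
    obtain ⟨A, hA, hAz⟩ := exists_of_prefixProb_ne_zero h1
    obtain ⟨B, hB, hBz⟩ := exists_of_prefixProb_ne_zero h2
    exact hu (A ∪ B) (hU A hA B hB) (by rw [encode_union, hAz, hBz, hz])
  · rfl

/-- The union of two coupled members of a union-closed family has entropy at most `log |F|`. -/
theorem sum_entropy_coupling_le_log_card (hF : F.Nonempty) (hU : UnionClosed F)
    (hr : IsDisjunctionRule r) :
    ∑ j ∈ Finset.range n, ∑ s : BitPrefix j, ∑ t : BitPrefix j,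
      coupling F r s t * binEntropy (r (condProb F s) (condProb F t)) ≤ log F.card := by
  refine (sum_entropy_le_entropy_joinProb hr n).trans ?_
  have hN : (0 : ℝ) < F.card := by exact_mod_cast hF.card_pos
  set I := F.image fun A => encode A n with hI
  have hout : ∀ u : BitPrefix n, u ∉ I → joinProb F r u = 0 := fun u hu =>
    joinProb_eq_zero hF hU hr fun A hA h => hu (Finset.mem_image.2 ⟨A, hA, h⟩)
  have h1 : ∑ u : BitPrefix n, negMulLog (joinProb F r u) =
      ∑ u ∈ I, negMulLog (joinProb F r u) := by
    symm
    exact Finset.sum_subset (Finset.subset_univ _) fun u _ hu => by simp [hout u hu]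
  have h2 : ∑ u ∈ I, joinProb F r u = 1 := by
    rw [← sum_joinProb (r := r) hF n]
    exact Finset.sum_subset (Finset.subset_univ _) fun u _ hu => hout u hu
  have h3 : (I.card : ℝ) * (F.card : ℝ)⁻¹ ≤ 1 := by
    rw [← div_eq_mul_inv, div_le_one hN]
    exact_mod_cast Finset.card_image_le
  rw [h1]
  calc ∑ u ∈ I, negMulLog (joinProb F r u)
      ≤ ∑ u ∈ I, (joinProb F r u * log F.card + (F.card : ℝ)⁻¹ - joinProb F r u) := by
        refine Finset.sum_le_sum fun u _ => ?_
        -- Gibbs' inequality against the constant weight 1/|F|.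
        have := negMulLog_le_reference (joinProb_nonneg (F := F) hr u) (inv_pos.2 hN)
        rw [log_inv] at this
        linarith
    _ = log F.card + I.card * (F.card : ℝ)⁻¹ - 1 := by
        rw [Finset.sum_sub_distrib, Finset.sum_add_distrib, ← Finset.sum_mul, h2, one_mul,
          Finset.sum_const, nsmul_eq_mul]
    _ ≤ log F.card := by linarith

/-! ### Frequent elements -/

/-- Summing the one-step gains would give log |F| < (1 - α) log |F| + α log |F|. -/
theorem CriticalParameters.log_card_lt_self {β k α : ℝ} (h : CriticalParameters β k α)
    (hF : F.Nonempty) (hU : UnionClosed F) (hlog : 0 < log F.card)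
    (hfreq : ∀ i : Fin n,
      1 < 2 * k * (1 - ((F.filter fun A => i ∈ A).card : ℝ) / F.card)) : False := by
  have hα0 := h.alpha_gt
  have hα1 := h.alpha_lt
  set E : ℕ → ℝ := fun j => ∑ s : BitPrefix j, prefixProb F s * binEntropy (condProb F s) with hE
  set K : ℕ → ℝ := fun j => ∑ s : BitPrefix j, ∑ t : BitPrefix j,
    coupling F (fun p q => p + q - p * q) s t *
      binEntropy (condProb F s + condProb F t - condProb F s * condProb F t) with hK
  set P : ℕ → ℝ := fun j => ∑ s : BitPrefix j, ∑ t : BitPrefix j,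
    coupling F maxEntropyRule s t * binEntropy (maxEntropyRule (condProb F s) (condProb F t))
    with hP
  have hstep : ∀ j ∈ Finset.range n, E j ≤ (1 - α) * K j + α * P j ∧
      (0 < E j → E j < (1 - α) * K j + α * P j) := by
    intro j hj
    have hr := isDisjunctionRule_maxEntropy
    have hmean : 1 < 2 * k * ∑ s : BitPrefix j, prefixProb F s * (1 - condProb F s) := by
      have h1 := sum_prefixProb_mul_condProb (F := F) ⟨j, Finset.mem_range.1 hj⟩
      have h2 := hfreq ⟨j, Finset.mem_range.1 hj⟩
      rw [← h1] at h2
      simp only [mul_sub, mul_one, Finset.sum_sub_distrib, sum_prefixProb hF] at h2 ⊢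
      exact h2
    have hgain := h.entropy_gain (w := fun s : BitPrefix j => prefixProb F s)
      (x := fun s => 1 - condProb F s) (γ := fun s t => coupling F maxEntropyRule s t)
      (g := fun s t => binEntropy (maxEntropyRule (condProb F s) (condProb F t)))
      (fun s => prefixProb_nonneg s) (sum_prefixProb hF j)
      (fun s => sub_nonneg.2 (condProb_le_one s)) (fun s => sub_le_self _ (condProb_nonneg s))
      hmean (fun s t => coupling_nonneg hr s t) (fun s => sum_coupling_right hF s)
      (fun t => sum_coupling_left hF t)
      (fun s t => binEntropy_nonneg (hr.mem_unitInterval s t).1 (hr.mem_unitInterval s t).2)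
      (fun s t => dualPotential_add_le (condProb_nonneg s) (condProb_nonneg t))
    have hEj : ∑ s : BitPrefix j, prefixProb F s * binEntropy (1 - condProb F s) = E j := by
      simp only [binEntropy_one_sub, hE]
    have hKj : ∑ s : BitPrefix j, ∑ t : BitPrefix j, prefixProb F s * prefixProb F t *
        binEntropy ((1 - condProb F s) * (1 - condProb F t)) = K j := by
      refine Finset.sum_congr rfl fun s _ => Finset.sum_congr rfl fun t _ => ?_
      rw [coupling_independent hF, ← binEntropy_one_sub (_ - _ * _)]
      congr 2
      ring
    rw [hEj, hKj] at hgain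
    exact hgain
  have hElog : log F.card ≤ ∑ j ∈ Finset.range n, E j := log_card_le_sum_prefixProb_entropy hF
  have hKlog : ∑ j ∈ Finset.range n, K j ≤ log F.card :=
    sum_entropy_coupling_le_log_card hF hU isDisjunctionRule_independent
  have hPlog : ∑ j ∈ Finset.range n, P j ≤ log F.card :=
    sum_entropy_coupling_le_log_card hF hU isDisjunctionRule_maxEntropy
  -- Positivity of log |F| forces a step of positive entropy, where the gain is strict.
  obtain ⟨j, hj, hpos⟩ : ∃ j ∈ Finset.range n, 0 < E j := by
    by_contra! hn
    linarith [Finset.sum_nonpos hn]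
  have hlt : ∑ j ∈ Finset.range n, E j < ∑ j ∈ Finset.range n, ((1 - α) * K j + α * P j) :=
    Finset.sum_lt_sum (fun j hj => (hstep j hj).1) ⟨j, hj, (hstep j hj).2 hpos⟩
  rw [Finset.sum_add_distrib, ← Finset.mul_sum, ← Finset.mul_sum] at hlt
  have h1 := mul_le_mul_of_nonneg_left hKlog (by linarith : 0 ≤ 1 - α)
  have h2 := mul_le_mul_of_nonneg_left hPlog (by linarith : 0 ≤ α)
  linarith

theorem CriticalParameters.exists_frequent {β k α c : ℝ} (h : CriticalParameters β k α)
    (hc : 2 * k * (1 - c) = 1) (hF : F.Nonempty) (hne : F ≠ {∅}) (hU : UnionClosed F) :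
    ∃ i : Fin n, c * (F.card : ℝ) ≤ ((F.filter fun A => i ∈ A).card : ℝ) := by
  have hk := h.k_gt
  have hc1 : c < 1 := by
    by_contra! hn
    nlinarith
  -- A singleton family has zero entropy, so the strict gain is unavailable; any element of its
  -- nonempty member works, as c < 1.
  by_cases hcard : F.card = 1
  · obtain ⟨A, rfl⟩ := Finset.card_eq_one.1 hcard
    obtain ⟨i, hi⟩ : A.Nonempty := by
      rw [Finset.nonempty_iff_ne_empty]
      rintro rfl
      exact hne rfl
    refine ⟨i, ?_⟩
    rw [Finset.filter_true_of_mem (by simpa using hi)]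
    simpa using hc1.le
  by_contra! hn
  have hN : 1 < F.card := by
    have := hF.card_pos
    omega
  have hN0 : (0 : ℝ) < F.card := by exact_mod_cast hF.card_pos
  refine h.log_card_lt_self hF hU (log_pos (by exact_mod_cast hN)) fun i => ?_
  rw [← hc]
  have : ((F.filter fun A => i ∈ A).card : ℝ) / F.card < c := by
    rw [div_lt_iff₀ hN0]
    exact hn i
  exact mul_lt_mul_of_pos_left (by linarith) (by linarith)

end UniformMember

theorem theorem1 :
    ∃ b c : ℝ,
      IsGreatest criticalRoots b ∧ c = twoPointMean b ∧
      0.3823455 < c ∧ c < 0.3823456 ∧ (3 - Real.sqrt 5) / 2 < c ∧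
      ∀ (n : ℕ) (F : Finset (Finset (Fin n))),
        F.Nonempty → F ≠ {∅} → UnionClosed F →
          ∃ i : Fin n, c * (F.card : ℝ) ≤ ((F.filter (fun A => i ∈ A)).card : ℝ) := by
  obtain ⟨b, hb, h0, h1, hgap⟩ := exists_isGreatest_criticalRoots
  obtain ⟨k, α, h, hc⟩ := exists_criticalParameters h0 h1 hgap
  have hk0 := h.k_gt
  have hk1 := h.k_lt
  -- Both numerical bounds on c follow from 2k(1 - c) = 1 and the enclosure of k.
  have hlow : 0.3823455 < twoPointMean b := by
    norm_num at hk0 hk1 ⊢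
    nlinarith
  have hsqrt : 2.2360 < sqrt 5 := lt_sqrt_of_sq_lt (by norm_num)
  refine ⟨b, twoPointMean b, hb, rfl, hlow, ?_, ?_, fun n F hF hne hU =>
    h.exists_frequent hc hF hne hU⟩
  · norm_num at hk0 hk1 ⊢
    nlinarith
  · norm_num at hsqrt hlow
    linarith
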